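/- **Theorem (Sobolev and Stein discrepancies).** Let $X\subset\mathbb R^d$ be compact with Lebesgue-null boundary, and let $\mu,P,Q$ be probability densities on $X$ (with respect to Lebesgue measure), where $\mu$ is continuous and strictly positive on $X$ and weakly differentiable in the interior of $X$ with locally square-integrable gradient, and $P,Q\in L^2(X)$ (for instance $P,Q$ continuous on $X$). Write $\mathbb E_p[f]=\int_X f(x)\,p(x)\,dx$. Let $W^{1,2}_0(X,\mu)$ be the space of weakly differentiable functions $f$ with $\mathbb E_\mu[f^2+\|\nabla f\|^2]<\infty$ that vanish at the boundary, i.e. that are limits, in the norm $(\mathbb E_\mu[f^2+\|\nabla f\|^2])^{1/2}$, of smooth functions with compact support in the interior of $X$. The Sobolev IPM is $$\mathcal S_\mu(P,Q)=\sup\bigl\{\mathbb E_P[f]-\mathbb E_Q[f]\;:\; f\in W^{1,2}_0(X,\mu),\ \mathbb E_\mu\|\nabla f\|^2\le 1\bigr\},$$ and an $f^*$ in this unit ball that attains the supremum is called an optimal critic. For a vector field $g:X\to\mathbb R^d$ with a weak divergence in the interior of $X$, let $T(\mu)g=\tfrac12\bigl(\langle\nabla\log\mu,g\rangle+\operatorname{div}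 g\bigr)$ be the Stein operator. For a class $\mathcal G$ of vector fields let $$\mathbb S_{\mathcal G}(Q,\mu)=\sup_{g\in\mathcal G}\bigl|\mathbb E_Q[T(\mu)g]\bigr|\in[0,\infty],$$ the supremum being over those $g\in\mathcal G$ for which $T(\mu)g$ is defined and $Q$-integrable, and let $\mathbb S(Q,\mu)$ be this quantity for the Stein class of $\mu$, i.e. the class of all $g$ for which $T(\mu)g$ is defined and $\mu$-integrable with $\mathbb E_\mu[T(\mu)g]=0$. Then $(Q-P)/\mu$ is $Q$-integrable and (with the convention $0\cdot\infty=0$) $$\Bigl|\mathbb E_{Q}\Bigl[\frac{Q-P}{\mu}\Bigr]\Bigr|\;\le\;2\,\mathbb S(Q,\mu)\,\mathcal S_\mu(P,Q).$$ Moreover, there is an optimal critic $f^*$ whose gradient belongs to the Stein class of $\mu$, and for every optimal critic $f^*$ and every class $\mathcal G$ of vector fields that contains $\nabla f^*$ (in particular for the class of all vector fields), $$\Bigl|\mathbb E_{Q}\Bigl[\frac{Q-P}{\mu}\Bigr]\Bigr|\;\le\;2\,\mathbb S_{\mathcal G}(Q,\mu)\,\mathcal S_\mu(P,Q).$$ 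-/

import Mathlib

open MeasureTheory Filter Topology
open scoped ENNReal ContDiff

namespace SobolevStein

/-- `p` is a probability density on `X` with respect to Lebesgue measure. -/
structure IsDensityOn {d : ℕ} (X : Set (EuclideanSpace ℝ (Fin d)))
    (p : EuclideanSpace ℝ (Fin d) → ℝ) : Prop where
  nonneg : ∀ x ∈ X, 0 ≤ p x
  integrableOn : IntegrableOn p X
  integral_eq_one : ∫ x in X, p x = 1

/-- The measure `p(x) dx` on `X`. Thus `∫ x, f x ∂(densityMeasure X p)` is `𝔼_{x ∼ p} f(x)`. -/
noncomputable def densityMeasure {d : ℕ} (X : Set (EuclideanSpace ℝ (Fin d)))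
    (p : EuclideanSpace ℝ (Fin d) → ℝ) : Measure (EuclideanSpace ℝ (Fin d)) :=
  (volume.restrict X).withDensity (fun x => ENNReal.ofReal (p x))

/-- Test functions `C_c^∞(Ω)`. -/
structure IsTestFunction {d : ℕ} (Ω : Set (EuclideanSpace ℝ (Fin d)))
    (φ : EuclideanSpace ℝ (Fin d) → ℝ) : Prop where
  contDiff : ContDiff ℝ ∞ φ
  hasCompactSupport : HasCompactSupport φ
  tsupport_subset : tsupport φ ⊆ Ω

/-- `v` is the weak gradient of `f` on `Ω`:
`∫_Ω f ∂_e φ = - ∫_Ω ⟨v, e⟩ φ` for all test functions `φ` and all directions `e`. -/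
structure HasWeakGradOn {d : ℕ} (Ω : Set (EuclideanSpace ℝ (Fin d)))
    (f : EuclideanSpace ℝ (Fin d) → ℝ)
    (v : EuclideanSpace ℝ (Fin d) → EuclideanSpace ℝ (Fin d)) : Prop where
  locallyIntegrableOn : LocallyIntegrableOn f Ω
  locallyIntegrableOn_grad : LocallyIntegrableOn v Ω
  integral_eq : ∀ φ : EuclideanSpace ℝ (Fin d) → ℝ, IsTestFunction Ω φ →
    ∀ e : EuclideanSpace ℝ (Fin d),
      ∫ x in Ω, f x * fderiv ℝ φ x e = - ∫ x in Ω, inner ℝ (v x) e * φ x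

/-- `w` is the weak divergence of the vector field `g` on `Ω`:
`∫_Ω ⟨g, ∇φ⟩ = - ∫_Ω w φ` for all test functions `φ`. -/
structure HasWeakDivOn {d : ℕ} (Ω : Set (EuclideanSpace ℝ (Fin d)))
    (g : EuclideanSpace ℝ (Fin d) → EuclideanSpace ℝ (Fin d))
    (w : EuclideanSpace ℝ (Fin d) → ℝ) : Prop where
  locallyIntegrableOn : LocallyIntegrableOn g Ω
  locallyIntegrableOn_div : LocallyIntegrableOn w Ω
  integral_eq : ∀ φ : EuclideanSpace ℝ (Fin d) → ℝ, IsTestFunction Ω φ →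
    ∫ x in Ω, inner ℝ (g x) (gradient φ x) = - ∫ x in Ω, w x * φ x

/-- `f`, with weak gradient `v`, belongs to `W₀^{1,2}(X, μ)`: both are square integrable against
`μ`, and `f` vanishes at the boundary of `X`, i.e. it is a limit in the `W^{1,2}(X, μ)` norm of
smooth functions with compact support in the interior of `X`. -/
structure MemSobolevZero {d : ℕ} (X : Set (EuclideanSpace ℝ (Fin d)))
    (μ f : EuclideanSpace ℝ (Fin d) → ℝ)
    (v : EuclideanSpace ℝ (Fin d) → EuclideanSpace ℝ (Fin d)) : Prop where
  hasWeakGradOn : HasWeakGradOn (interior X) f v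
  memLp : MemLp f 2 (densityMeasure X μ)
  memLp_grad : MemLp v 2 (densityMeasure X μ)
  exists_approx : ∃ φ : ℕ → EuclideanSpace ℝ (Fin d) → ℝ,
    (∀ n, IsTestFunction (interior X) (φ n)) ∧
    Tendsto (fun n => eLpNorm (fun x => φ n x - f x) 2 (densityMeasure X μ)) atTop (𝓝 0) ∧
    Tendsto (fun n => eLpNorm (fun x => gradient (φ n) x - v x) 2 (densityMeasure X μ))
      atTop (𝓝 0)

/-- The unit ball `{f ∈ W₀^{1,2}(X, μ) : 𝔼_μ ‖∇f‖² ≤ 1}`; `v` is the gradient of `f`. -/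
def InSobolevBall {d : ℕ} (X : Set (EuclideanSpace ℝ (Fin d)))
    (μ f : EuclideanSpace ℝ (Fin d) → ℝ)
    (v : EuclideanSpace ℝ (Fin d) → EuclideanSpace ℝ (Fin d)) : Prop :=
  MemSobolevZero X μ f v ∧ ∫ x, ‖v x‖ ^ 2 ∂(densityMeasure X μ) ≤ 1

/-- The mean discrepancy `𝔼_P f - 𝔼_Q f`. -/
noncomputable def meanDiscrepancy {d : ℕ} (X : Set (EuclideanSpace ℝ (Fin d)))
    (P Q f : EuclideanSpace ℝ (Fin d) → ℝ) : ℝ :=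
  (∫ x, f x ∂(densityMeasure X P)) - ∫ x, f x ∂(densityMeasure X Q)

/-- The Sobolev IPM `S_μ(P, Q)`: the supremum of `𝔼_P f - 𝔼_Q f` over the unit ball of
`W₀^{1,2}(X, μ)`. The ball contains `0`, so the supremum is nonnegative and may be taken
in `[0, ∞]`. -/
noncomputable def sobolevIPM {d : ℕ} (X : Set (EuclideanSpace ℝ (Fin d)))
    (μ P Q : EuclideanSpace ℝ (Fin d) → ℝ) : ℝ≥0∞ :=
  ⨆ (f : EuclideanSpace ℝ (Fin d) → ℝ)
    (v : EuclideanSpace ℝ (Fin d) → EuclideanSpace ℝ (Fin d))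
    (_ : InSobolevBall X μ f v), ENNReal.ofReal (meanDiscrepancy X P Q f)

/-- `f`, with gradient `v`, is an optimal critic: it attains the supremum that defines the
Sobolev IPM. -/
def IsSobolevCritic {d : ℕ} (X : Set (EuclideanSpace ℝ (Fin d)))
    (μ P Q f : EuclideanSpace ℝ (Fin d) → ℝ)
    (v : EuclideanSpace ℝ (Fin d) → EuclideanSpace ℝ (Fin d)) : Prop :=
  InSobolevBall X μ f v ∧
    ∀ (f' : EuclideanSpace ℝ (Fin d) → ℝ)
      (v' : EuclideanSpace ℝ (Fin d) → EuclideanSpace ℝ (Fin d)),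
      InSobolevBall X μ f' v' → meanDiscrepancy X P Q f' ≤ meanDiscrepancy X P Q f

/-- `t = T(μ) g`, where `T(μ) g = ½ (⟨∇ log μ, g⟩ + div g)` is the Stein operator. -/
def IsSteinImage {d : ℕ} (X : Set (EuclideanSpace ℝ (Fin d)))
    (μ : EuclideanSpace ℝ (Fin d) → ℝ)
    (g : EuclideanSpace ℝ (Fin d) → EuclideanSpace ℝ (Fin d))
    (t : EuclideanSpace ℝ (Fin d) → ℝ) : Prop :=
  ∃ (s : EuclideanSpace ℝ (Fin d) → EuclideanSpace ℝ (Fin d))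
    (w : EuclideanSpace ℝ (Fin d) → ℝ),
    HasWeakGradOn (interior X) (fun x => Real.log (μ x)) s ∧
    HasWeakDivOn (interior X) g w ∧
    ∀ x, t x = (1 / 2) * (inner ℝ (s x) (g x) + w x)

/-- The Stein class of `μ`: the vector fields `g` on `X` for which `T(μ) g` is defined and has
mean zero under `μ`. -/
def steinClass {d : ℕ} (X : Set (EuclideanSpace ℝ (Fin d)))
    (μ : EuclideanSpace ℝ (Fin d) → ℝ) :
    Set (EuclideanSpace ℝ (Fin d) → EuclideanSpace ℝ (Fin d)) :=
  {g | ∃ t : EuclideanSpace ℝ (Fin d) → ℝ, IsSteinImage X μ g t ∧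
    Integrable t (densityMeasure X μ) ∧ ∫ x, t x ∂(densityMeasure X μ) = 0}

/-- The Stein discrepancy `sup_g |𝔼_Q [T(μ) g]| ∈ [0, ∞]` over those vector fields `g` in the
class `𝒢` for which `T(μ) g` is defined and has an expectation under `Q`. -/
noncomputable def steinDiscrepancy {d : ℕ} (X : Set (EuclideanSpace ℝ (Fin d)))
    (𝒢 : Set (EuclideanSpace ℝ (Fin d) → EuclideanSpace ℝ (Fin d)))
    (Q μ : EuclideanSpace ℝ (Fin d) → ℝ) : ℝ≥0∞ :=
  ⨆ (g : EuclideanSpace ℝ (Fin d) → EuclideanSpace ℝ (Fin d)) (_ : g ∈ 𝒢)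
    (t : EuclideanSpace ℝ (Fin d) → ℝ) (_ : IsSteinImage X μ g t)
    (_ : Integrable t (densityMeasure X Q)),
    ENNReal.ofReal |∫ x, t x ∂(densityMeasure X Q)|

end SobolevStein

namespace SobolevStein

open scoped Convolution

/-! Put `h = (P - Q) / μ`, an element of `L²(μ)` because `μ` is bounded away from zero on the
compact set `X`. The mean discrepancy of `f` is the `L²(μ)` inner product of `h` and `f`. Let `V` be
the closure of the pairs `(φ, ∇φ)`, with `φ` a test function, in `L²(μ) × L²(μ; ℝ^d)`. The Poincaré
inequality makes the gradient form coercive on `V`, so Lax–Milgram yields `u ∈ V` with `⟨∇u, ∇z⟩ =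
⟨h, z⟩` for all `z ∈ V` (`exists_dual`). The discrepancy of `f` is therefore `⟨∇u, ∇f⟩`. By
Cauchy–Schwarz its maximum on the unit ball is `S = ‖∇u‖`, attained at `u / S`. If `S ≠ 0`, the
equality case forces every optimal critic to have gradient `∇u / S` (`eq_smul_of_norm_le_inner`).

The equation for `u` says `-div(μ ∇u) = P - Q`. Since `T(μ) g = div(μ g) / (2 μ)`, an optimal critic
satisfies `T(μ) ∇f* = (Q - P) / (2 S μ)`. Its mean under `μ` vanishes because `P` and `Q` have equal
mass, so `∇f*` lies in the Stein class. Its mean under `Q` is `E_Q[(Q - P) / μ] / (2 S)`, and using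
`∇f*` as a competitor in the Stein discrepancy gives the inequality. If `S = 0`, then `P = Q` almost
everywhere and the left side is zero.

The analytic difficulty is the formula for `T(μ)`: `μ` is only continuous with a locally
square-integrable weak gradient, and `div(μ ∇u)` is only known weakly. Mollifying `μ` near the
support of a test function (`exists_contDiff_approx`) justifies the chain rule for `log μ`
(`hasWeakGradOn_log`) and the product rule (`hasWeakDivOn_of_weighted`). -/

theorem eLpNorm_two_sq {α F : Type*} [NormedAddCommGroup F] [MeasurableSpace α] {π : Measure α} (h : α → F) :
    eLpNorm h 2 π ^ 2 = ∫⁻ y, ‖h y‖ₑ ^ 2 ∂π := by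
  rw [eLpNorm_eq_lintegral_rpow_enorm_toReal (by norm_num) (by norm_num)]
  rw [← ENNReal.rpow_natCast, ← ENNReal.rpow_mul]
  norm_num

theorem enorm_integral_sq_le {α F : Type*} [NormedAddCommGroup F] [NormedSpace ℝ F] [MeasurableSpace α] {π : Measure α}
    [IsProbabilityMeasure π] {h : α → F} (hh : AEStronglyMeasurable h π) :
    ‖∫ y, h y ∂π‖ₑ ^ 2 ≤ ∫⁻ y, ‖h y‖ₑ ^ 2 ∂π := by
  have h1 : ‖∫ y, h y ∂π‖ₑ ≤ eLpNorm h 2 π :=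
    (enorm_integral_le_lintegral_enorm h).trans
      (eLpNorm_one_eq_lintegral_enorm.symm.le.trans
        (eLpNorm_le_eLpNorm_of_exponent_le (by norm_num) hh))
  exact (pow_le_pow_left₀ zero_le h1 2).trans_eq (eLpNorm_two_sq h)

/-! ### Mollification in `L²`. -/

section Mollification

variable {G F : Type*} [NormedAddCommGroup G] [NormedSpace ℝ G] [FiniteDimensional ℝ G]
  [MeasurableSpace G] [BorelSpace G] {vol : Measure G} [vol.IsAddHaarMeasure]
  [NormedAddCommGroup F]

theorem tendsto_eLpNorm_comp_sub_right {f : G → F} (hf : MemLp f 2 vol) :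
    Tendsto (fun y => eLpNorm (fun x => f (x - y) - f x) 2 vol) (𝓝 0) (𝓝 0) := by
  -- Translations depend continuously on `y` in the compact-open topology and preserve the measure;
  -- composition with such maps is continuous in `L²`.
  let g : C(G, C(G, G)) := ContinuousMap.curry ⟨fun p : G × G => p.2 - p.1, by fun_prop⟩
  have hgm : ∀ y, MeasurePreserving (g y) vol vol := fun y => measurePreserving_sub_right vol y
  have h1 := Filter.Tendsto.compMeasurePreservingLp (l := 𝓝 (0 : G)) (f := fun _ => hf.toLp f)
    (g := g) (tendsto_const_nhds) (g.continuous.tendsto 0) hgm (hgm 0) (by norm_num)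
  have h2 := (tendsto_iff_edist_tendsto_0.1 h1)
  have h0 : Lp.compMeasurePreserving (g 0) (hgm 0) (hf.toLp f) = hf.toLp f := by
    rw [Lp.toLp_compMeasurePreserving hf (hgm 0)]
    congr 1
    ext x
    simp [g]
  rw [h0] at h2
  refine h2.congr fun y => ?_
  rw [Lp.toLp_compMeasurePreserving hf (hgm y), Lp.edist_toLp_toLp]
  rfl

theorem isProbabilityMeasure_normed (φ : ContDiffBump (0 : G)) :
    IsProbabilityMeasure (vol.withDensity fun y => ENNReal.ofReal (φ.normed vol y)) := by
  constructor
  rw [withDensity_apply _ .univ, Measure.restrict_univ,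
    ← ofReal_integral_eq_lintegral_ofReal φ.integrable_normed
    (ae_of_all _ φ.nonneg_normed), φ.integral_normed, ENNReal.ofReal_one]

variable [NormedSpace ℝ F] [CompleteSpace F]

theorem normed_convolution_sub_eq (φ : ContDiffBump (0 : G)) {f : G → F}
    (hf : LocallyIntegrable f vol) (x : G) :
    (φ.normed vol ⋆[ContinuousLinearMap.lsmul ℝ ℝ, vol] f) x - f x =
      ∫ y, (f (x - y) - f x) ∂(vol.withDensity fun y => ENNReal.ofReal (φ.normed vol y)) := by
  rw [integral_withDensity_eq_integral_toReal_smul₀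
    (φ.continuous_normed.measurable.ennreal_ofReal.aemeasurable) (by simp)]
  simp only [ENNReal.toReal_ofReal (φ.nonneg_normed _), smul_sub]
  rw [integral_sub, φ.integral_normed_smul]
  · rfl
  · exact (φ.hasCompactSupport_normed.convolutionExists_left
      (ContinuousLinearMap.lsmul ℝ ℝ) φ.continuous_normed hf x)
  · exact φ.integrable_normed.smul_const _

/-- The normalised bump is a probability density, so Jensen's inequality bounds the squared error
pointwise by an average of squared translation errors; Tonelli then exchanges the integrals. Strong
measurability of `f` itself supplies the joint measurability. -/
theorem eLpNorm_normed_convolution_sub_le (φ : ContDiffBump (0 : G)) {f : G → F}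
    (hf : LocallyIntegrable f vol) (hfm : StronglyMeasurable f) {C : ℝ≥0∞}
    (hC : ∀ y ∈ Metric.ball (0 : G) φ.rOut, eLpNorm (fun x => f (x - y) - f x) 2 vol ≤ C) :
    eLpNorm (fun x => (φ.normed vol ⋆[ContinuousLinearMap.lsmul ℝ ℝ, vol] f) x - f x) 2 vol
      ≤ C := by
  have := isProbabilityMeasure_normed (vol := vol) φ
  set π := vol.withDensity fun y => ENNReal.ofReal (φ.normed vol y) with hπ
  have hm : StronglyMeasurable (fun p : G × G => f (p.1 - p.2) - f p.1) :=
    (hfm.comp_measurable (measurable_fst.sub measurable_snd)).sub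
      (hfm.comp_measurable measurable_fst)
  have key : eLpNorm (fun x => (φ.normed vol ⋆[ContinuousLinearMap.lsmul ℝ ℝ, vol] f) x - f x)
      2 vol ^ 2 ≤ C ^ 2 := by
    rw [eLpNorm_two_sq]
    calc ∫⁻ x, ‖(φ.normed vol ⋆[ContinuousLinearMap.lsmul ℝ ℝ, vol] f) x - f x‖ₑ ^ 2 ∂vol
        ≤ ∫⁻ x, ∫⁻ y, ‖f (x - y) - f x‖ₑ ^ 2 ∂π ∂vol := by
          refine lintegral_mono fun x => ?_
          rw [normed_convolution_sub_eq φ hf]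
          exact enorm_integral_sq_le
            (hm.comp_measurable measurable_prodMk_left).aestronglyMeasurable
      _ = ∫⁻ y, ∫⁻ x, ‖f (x - y) - f x‖ₑ ^ 2 ∂vol ∂π := by
          refine lintegral_lintegral_swap ?_
          exact (hm.enorm.pow_const 2).aemeasurable
      _ ≤ ∫⁻ y, C ^ 2 ∂π := by
          refine lintegral_mono_ae ?_
          rw [hπ, ae_withDensity_iff φ.continuous_normed.measurable.ennreal_ofReal]
          refine ae_of_all _ fun y hy => ?_
          rw [← eLpNorm_two_sq]
          gcongr
          refine hC y ?_
          rw [← φ.support_normed_eq (μ := vol)]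
          intro h
          simp [h] at hy
      _ = C ^ 2 := by simp
  exact (ENNReal.pow_le_pow_left_iff two_ne_zero).1 key

/-- Mollification converges in `L²`. -/
theorem tendsto_eLpNorm_normed_convolution_sub {φ : ℕ → ContDiffBump (0 : G)}
    (hφ : Tendsto (fun n => (φ n).rOut) atTop (𝓝 0)) {f : G → F} (hf : MemLp f 2 vol) :
    Tendsto (fun n => eLpNorm (fun x =>
      ((φ n).normed vol ⋆[ContinuousLinearMap.lsmul ℝ ℝ, vol] f) x - f x) 2 vol)
      atTop (𝓝 0) := by
  obtain ⟨f', hf'm, hff'⟩ := hf.1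
  have hf' : MemLp f' 2 vol := hf.ae_eq hff'
  have hloc : LocallyIntegrable f' vol := hf'.locallyIntegrable (by norm_num)
  have heq : ∀ n, eLpNorm (fun x =>
      ((φ n).normed vol ⋆[ContinuousLinearMap.lsmul ℝ ℝ, vol] f) x - f x) 2 vol =
      eLpNorm (fun x =>
      ((φ n).normed vol ⋆[ContinuousLinearMap.lsmul ℝ ℝ, vol] f') x - f' x) 2 vol := by
    intro n
    refine eLpNorm_congr_ae ?_
    filter_upwards [hff'] with x hx
    rw [hx, convolution_congr _ (ae_eq_refl _) hff']
  simp_rw [heq]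
  rw [ENNReal.tendsto_atTop_zero]
  intro ε hε
  have h1 := (tendsto_eLpNorm_comp_sub_right hf').eventually (ge_mem_nhds hε)
  obtain ⟨δ, hδ, hball⟩ := Metric.eventually_nhds_iff_ball.1 h1
  obtain ⟨N, hN⟩ := (hφ.eventually (gt_mem_nhds hδ)).exists_forall_of_atTop
  refine ⟨N, fun n hn => eLpNorm_normed_convolution_sub_le _ hloc hf'm fun y hy => hball y ?_⟩
  exact Metric.ball_subset_ball (hN n hn).le hy

end Mollification

/-! ### Mollification and weak gradients. -/

theorem IsTestFunction.fderiv_eq_zero_of_notMem {d : ℕ} {Ω : Set (EuclideanSpace ℝ (Fin d))}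
    {φ : EuclideanSpace ℝ (Fin d) → ℝ} (hφ : IsTestFunction Ω φ) {x : EuclideanSpace ℝ (Fin d)}
    (hx : x ∉ Ω) : fderiv ℝ φ x = 0 :=
  image_eq_zero_of_notMem_tsupport fun h =>
    hx (hφ.tsupport_subset (tsupport_fderiv_subset ℝ h))

theorem IsTestFunction.eq_zero_of_notMem {d : ℕ} {Ω : Set (EuclideanSpace ℝ (Fin d))}
    {φ : EuclideanSpace ℝ (Fin d) → ℝ} (hφ : IsTestFunction Ω φ) {x : EuclideanSpace ℝ (Fin d)}
    (hx : x ∉ Ω) : φ x = 0 :=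
  image_eq_zero_of_notMem_tsupport fun h => hx (hφ.tsupport_subset h)

theorem inner_gradient {H : Type*} [NormedAddCommGroup H] [InnerProductSpace ℝ H]
    [CompleteSpace H] (φ : H → ℝ) (x e : H) : inner ℝ (gradient φ x) e = fderiv ℝ φ x e := by
  simp [gradient]

theorem isTestFunction_normed_sub {d : ℕ} {Ω : Set (EuclideanSpace ℝ (Fin d))}
    (ρ : ContDiffBump (0 : EuclideanSpace ℝ (Fin d))) {x : EuclideanSpace ℝ (Fin d)}
    (hx : Metric.closedBall x ρ.rOut ⊆ Ω) :
    IsTestFunction Ω (fun t => ρ.normed volume (x - t)) := by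
  have hs : tsupport (fun t => ρ.normed volume (x - t)) ⊆ Metric.closedBall x ρ.rOut := by
    refine closure_minimal ?_ Metric.isClosed_closedBall
    intro t ht
    have : x - t ∈ Function.support (ρ.normed volume) := ht
    rw [ρ.support_normed_eq, mem_ball_zero_iff] at this
    rw [Metric.mem_closedBall, dist_comm, dist_eq_norm]
    exact this.le
  refine ⟨?_, HasCompactSupport.of_support_subset_isCompact (isCompact_closedBall x ρ.rOut)
    ((subset_tsupport _).trans hs), hs.trans hx⟩
  have h : ContDiff ℝ ∞ (ρ.normed volume) := ρ.contDiff_normed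
  exact h.comp (contDiff_const.sub contDiff_id)

theorem fderiv_normed_convolution_apply {d : ℕ}
    (ρ : ContDiffBump (0 : EuclideanSpace ℝ (Fin d))) {f : EuclideanSpace ℝ (Fin d) → ℝ}
    (hf : LocallyIntegrable f) (x e : EuclideanSpace ℝ (Fin d)) :
    fderiv ℝ (ρ.normed volume ⋆[ContinuousLinearMap.lsmul ℝ ℝ, volume] f) x e =
      - ∫ t, f t * fderiv ℝ (fun t => ρ.normed volume (x - t)) t e := by
  have hρ : ContDiff ℝ 1 (ρ.normed volume) := ρ.contDiff_normed (n := 1)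
  rw [← convolution_flip, (ρ.hasCompactSupport_normed.hasFDerivAt_convolution_right
    (ContinuousLinearMap.lsmul ℝ ℝ).flip hf hρ x).fderiv,
    convolution_precompR_apply _ hf (ρ.hasCompactSupport_normed.fderiv ℝ)
      (hρ.continuous_fderiv one_ne_zero), convolution_def, ← integral_neg]
  congr 1
  ext t
  have h1 : HasFDerivAt (fun t => ρ.normed volume (x - t))
      ((fderiv ℝ (ρ.normed volume) (x - t)).comp
        (-(ContinuousLinearMap.id ℝ (EuclideanSpace ℝ (Fin d))))) t :=
    HasFDerivAt.comp t ((hρ.differentiable one_ne_zero) (x - t)).hasFDerivAt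
      ((hasFDerivAt_id t).const_sub x)
  rw [h1.fderiv]
  simp [mul_comm]

/-- Differentiating under the convolution puts the derivative on `t ↦ ρ (x - t)`, which is a test
function supported in `K`, and the weak gradient identity moves it onto `f`. Cutting off to `K`
makes `v` globally integrable and does not affect the value at `x`. -/
theorem gradient_normed_convolution_eq {d : ℕ} {Ω K : Set (EuclideanSpace ℝ (Fin d))}
    {f f' : EuclideanSpace ℝ (Fin d) → ℝ}
    {v : EuclideanSpace ℝ (Fin d) → EuclideanSpace ℝ (Fin d)} (hfv : HasWeakGradOn Ω f v)
    (hf' : LocallyIntegrable f') (hff' : Set.EqOn f f' Ω) (hΩ : IsOpen Ω)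
    (hK : IsCompact K) (hKΩ : K ⊆ Ω)
    (ρ : ContDiffBump (0 : EuclideanSpace ℝ (Fin d))) {x : EuclideanSpace ℝ (Fin d)}
    (hx : Metric.closedBall x ρ.rOut ⊆ K) :
    gradient (ρ.normed volume ⋆[ContinuousLinearMap.lsmul ℝ ℝ, volume] f') x =
      (ρ.normed volume ⋆[ContinuousLinearMap.lsmul ℝ ℝ, volume] (K.indicator v)) x := by
  have htest := isTestFunction_normed_sub ρ (hx.trans hKΩ)
  have htestK := isTestFunction_normed_sub ρ hx
  have hv : Integrable (K.indicator v) :=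
    (integrable_indicator_iff hK.measurableSet).2
      (hfv.locallyIntegrableOn_grad.integrableOn_compact_subset hKΩ hK)
  refine ext_inner_right ℝ fun e => ?_
  rw [inner_gradient, fderiv_normed_convolution_apply ρ hf', convolution_eq_swap,
    real_inner_comm, ← integral_inner]
  · have h := hfv.integral_eq _ htest e
    rw [setIntegral_congr_fun hΩ.measurableSet
      (g := fun t => f' t * fderiv ℝ (fun t => ρ.normed volume (x - t)) t e)
      (fun t ht => by simp only [hff' ht])] at h
    rw [← setIntegral_eq_integral_of_forall_compl_eq_zero (s := Ω), h, neg_neg,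
      setIntegral_eq_integral_of_forall_compl_eq_zero]
    · congr 1
      ext t
      by_cases ht : t ∈ K
      · simp [Set.indicator_of_mem ht, inner_smul_right, real_inner_comm, mul_comm]
      · simp [htestK.eq_zero_of_notMem ht]
    · intro t ht
      rw [htest.eq_zero_of_notMem ht, mul_zero]
    · intro t ht
      rw [htest.fderiv_eq_zero_of_notMem ht]; simp
  · exact (ρ.hasCompactSupport_normed.convolutionExists_left (ContinuousLinearMap.lsmul ℝ ℝ)
      ρ.continuous_normed hv.locallyIntegrable x).integrable_swap

/-! ### Smooth approximation of the weight. -/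

theorem exists_bounds_of_continuousOn_pos {α : Type*} [TopologicalSpace α] {X : Set α}
    (hX : IsCompact X) {μ : α → ℝ} (hμ : ContinuousOn μ X) (hpos : ∀ x ∈ X, 0 < μ x) :
    ∃ a b : ℝ, 0 < a ∧ a ≤ b ∧ ∀ x ∈ X, a ≤ μ x ∧ μ x ≤ b := by
  rcases X.eq_empty_or_nonempty with rfl | hne
  · exact ⟨1, 1, one_pos, le_rfl, by simp⟩
  · obtain ⟨x, hx, hxm⟩ := hX.exists_isMinOn hne hμ
    obtain ⟨y, hy, hym⟩ := hX.exists_isMaxOn hne hμ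
    exact ⟨μ x, μ y, hpos x hx, hxm hy, fun z hz => ⟨hxm hz, hym hz⟩⟩

theorem normed_convolution_mem_Icc {d : ℕ}
    (ρ : ContDiffBump (0 : EuclideanSpace ℝ (Fin d))) {f : EuclideanSpace ℝ (Fin d) → ℝ}
    (hf : LocallyIntegrable f) {a b : ℝ} (hab : ∀ x, f x ∈ Set.Icc a b)
    (x : EuclideanSpace ℝ (Fin d)) :
    (ρ.normed volume ⋆[ContinuousLinearMap.lsmul ℝ ℝ, volume] f) x ∈ Set.Icc a b := by
  have hi : Integrable (fun t => ρ.normed volume t • f (x - t)) :=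
    ρ.hasCompactSupport_normed.convolutionExists_left (ContinuousLinearMap.lsmul ℝ ℝ)
      ρ.continuous_normed hf x
  have hc : ∀ c : ℝ, ∫ t, ρ.normed volume t • c = c := fun c => by
    rw [ρ.integral_normed_smul]
  rw [convolution_def]
  simp only [ContinuousLinearMap.lsmul_apply]
  constructor
  · refine (hc a).symm.le.trans
      (integral_mono (ρ.integrable_normed.smul_const _) hi fun t => ?_)
    exact smul_le_smul_of_nonneg_left (hab _).1 (ρ.nonneg_normed t)
  · refine (integral_mono hi (ρ.integrable_normed.smul_const _) fun t => ?_).trans (hc b).le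
    exact smul_le_smul_of_nonneg_left (hab _).2 (ρ.nonneg_normed t)

/-- A continuous positive function with locally square integrable weak gradient is approximated
near a compact set by smooth functions that are bounded above and away from zero. -/
theorem exists_contDiff_approx {d : ℕ} {X K : Set (EuclideanSpace ℝ (Fin d))} (hX : IsCompact X)
    {μ : EuclideanSpace ℝ (Fin d) → ℝ}
    {m : EuclideanSpace ℝ (Fin d) → EuclideanSpace ℝ (Fin d)}
    (hμ : ContinuousOn μ X) (hpos : ∀ x ∈ X, 0 < μ x) (hm : HasWeakGradOn (interior X) μ m)
    (hm2 : LocallyIntegrableOn (fun x => ‖m x‖ ^ 2) (interior X))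
    (hK : IsCompact K) (hKX : K ⊆ interior X) :
    ∃ (μ' : ℕ → EuclideanSpace ℝ (Fin d) → ℝ) (a b : ℝ), 0 < a ∧ a ≤ b ∧
      (∀ n, ContDiff ℝ ∞ (μ' n)) ∧ (∀ n x, μ' n x ∈ Set.Icc a b) ∧
      (∀ x ∈ K, Tendsto (fun n => μ' n x) atTop (𝓝 (μ x))) ∧
      MemLp m 2 (volume.restrict K) ∧
      Tendsto (fun n => eLpNorm (fun x => gradient (μ' n) x - m x) 2 (volume.restrict K))
        atTop (𝓝 0) := by
  classical
  obtain ⟨a, b, ha, hab, hμab⟩ := exists_bounds_of_continuousOn_pos hX hμ hpos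
  obtain ⟨δ, hδ, hδX⟩ := hK.exists_cthickening_subset_open isOpen_interior hKX
  have hK' : IsCompact (Metric.cthickening δ K) := hK.cthickening
  have hmK' : MemLp m 2 (volume.restrict (Metric.cthickening δ K)) :=
    (memLp_two_iff_integrable_sq_norm
      (hm.locallyIntegrableOn_grad.integrableOn_compact_subset hδX hK').aestronglyMeasurable).2
      (hm2.integrableOn_compact_subset hδX hK')
  -- Extending by the lower bound `a`, rather than by zero, keeps all values in `[a, b]`. Averaging
  -- preserves this interval, so the approximants have uniformly bounded logarithms and inverses.
  set f : EuclideanSpace ℝ (Fin d) → ℝ := X.piecewise μ (fun _ => a) with hf_def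
  have hfab : ∀ x, f x ∈ Set.Icc a b := by
    intro x
    by_cases hx : x ∈ X
    · rw [hf_def, Set.piecewise_eq_of_mem _ _ _ hx]
      exact hμab x hx
    · rw [hf_def, Set.piecewise_eq_of_notMem _ _ _ hx]
      exact ⟨le_rfl, hab⟩
  have hfm : AEStronglyMeasurable f :=
    AEStronglyMeasurable.piecewise hX.measurableSet
      (hμ.aestronglyMeasurable hX.measurableSet) aestronglyMeasurable_const
  have hf : LocallyIntegrable f := by
    refine (locallyIntegrable_const b).mono hfm (ae_of_all _ fun x => ?_)
    rw [Real.norm_of_nonneg (ha.le.trans (hfab x).1), Real.norm_of_nonneg (ha.le.trans hab)]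
    exact (hfab x).2
  have hfX : Set.EqOn μ f X := fun x hx => (Set.piecewise_eq_of_mem _ _ _ hx).symm
  -- Outer radii at most `δ` keep every ball centred in `K` inside the `δ`-thickening, where the
  -- weak gradient is square integrable.
  let ρ : ℕ → ContDiffBump (0 : EuclideanSpace ℝ (Fin d)) := fun n =>
    ⟨δ / (n + 2), δ / (n + 1), by positivity, by gcongr; norm_num⟩
  have hρ : Tendsto (fun n => (ρ n).rOut) atTop (𝓝 0) :=
    tendsto_const_nhds.div_atTop (tendsto_natCast_atTop_atTop.atTop_add tendsto_const_nhds)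
  have hρδ : ∀ n, (ρ n).rOut ≤ δ := fun n => by
    change δ / (n + 1) ≤ δ
    exact div_le_self hδ.le (by simp)
  refine ⟨fun n => (ρ n).normed volume ⋆[ContinuousLinearMap.lsmul ℝ ℝ, volume] f, a, b, ha, hab,
    fun n => ?_, fun n x => normed_convolution_mem_Icc (ρ n) hf hfab x, fun x hx => ?_,
    hmK'.mono_measure (Measure.restrict_mono (Metric.self_subset_cthickening K) le_rfl), ?_⟩
  · exact (ρ n).hasCompactSupport_normed.contDiff_convolution_left _ (ρ n).contDiff_normed hf
  · have hxX := mem_interior_iff_mem_nhds.1 (hKX hx)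
    have hc : ContinuousAt f x :=
      (hμ.continuousAt hxX).congr (by filter_upwards [hxX] with y hy using hfX hy)
    rw [hfX (interior_subset (hKX hx))]
    exact ContDiffBump.convolution_tendsto_right hρ (Eventually.of_forall fun _ => hfm)
      (hc.tendsto.comp tendsto_snd) tendsto_const_nhds
  · have hmi : MemLp ((Metric.cthickening δ K).indicator m) 2 :=
      (memLp_indicator_iff_restrict hK'.measurableSet).2 hmK'
    refine tendsto_of_tendsto_of_tendsto_of_le_of_le tendsto_const_nhds
      (tendsto_eLpNorm_normed_convolution_sub hρ hmi) (fun _ => zero_le) fun n => ?_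
    refine le_trans (le_of_eq ?_) (eLpNorm_restrict_le _ _ _ K)
    refine eLpNorm_congr_ae ?_
    filter_upwards [ae_restrict_mem hK.measurableSet] with x hx
    rw [Set.indicator_of_mem (Metric.self_subset_cthickening K hx),
      gradient_normed_convolution_eq hm hf (hfX.mono interior_subset) isOpen_interior hK' hδX]
    exact (Metric.closedBall_subset_closedBall (hρδ n)).trans
      (Metric.closedBall_subset_cthickening hx δ)

/-! ### Limits of products under the integral. -/

theorem tendsto_integral_mul_of_bounded {α : Type*} [MeasurableSpace α] {π : Measure α}
    {g : ℕ → α → ℝ} {g₀ F : α → ℝ} {C : ℝ}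
    (hgm : ∀ n, AEStronglyMeasurable (g n) π) (hgC : ∀ n, ∀ᵐ x ∂π, ‖g n x‖ ≤ C)
    (hg : ∀ᵐ x ∂π, Tendsto (fun n => g n x) atTop (𝓝 (g₀ x))) (hF : Integrable F π) :
    Tendsto (fun n => ∫ x, g n x * F x ∂π) atTop (𝓝 (∫ x, g₀ x * F x ∂π)) := by
  refine tendsto_integral_of_dominated_convergence (fun x => C * ‖F x‖)
    (fun n => (hgm n).mul hF.1) (hF.norm.const_mul C) (fun n => ?_) ?_
  · filter_upwards [hgC n] with x hx
    rw [norm_mul]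
    gcongr
  · filter_upwards [hg] with x hx using hx.mul_const _

theorem _root_.MeasureTheory.MemLp.integrable_inner_mul {α H : Type*} [MeasurableSpace α]
    {π : Measure α} [NormedAddCommGroup H] [InnerProductSpace ℝ H] {f g : α → H}
    (hf : MemLp f 2 π) (hg : MemLp g 2 π) : Integrable (fun x => inner ℝ (f x) (g x)) π :=
  memLp_one_iff_integrable.1 (MemLp.of_bilin (r := 1) (fun a b => inner ℝ a b) 1 hf hg
    (hf.1.inner hg.1) (ae_of_all _ fun x => by simpa using nnnorm_inner_le_nnnorm (𝕜 := ℝ) (f x) (g x)))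

/-- Split `G n` as `(G n - G₀) + G₀`: Hölder and the uniform bound dispose of the first part,
dominated convergence handles the second. -/
theorem tendsto_integral_mul_inner {α H : Type*} [MeasurableSpace α] {π : Measure α}
    [NormedAddCommGroup H] [InnerProductSpace ℝ H]
    {g : ℕ → α → ℝ} {g₀ : α → ℝ} {C : ℝ} {G : ℕ → α → H} {G₀ w : α → H}
    (hgm : ∀ n, AEStronglyMeasurable (g n) π) (hgC : ∀ n, ∀ᵐ x ∂π, ‖g n x‖ ≤ C)
    (hg : ∀ᵐ x ∂π, Tendsto (fun n => g n x) atTop (𝓝 (g₀ x)))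
    (hGm : ∀ n, MemLp (G n) 2 π) (hG₀ : MemLp G₀ 2 π) (hw : MemLp w 2 π)
    (hG : Tendsto (fun n => eLpNorm (fun x => G n x - G₀ x) 2 π) atTop (𝓝 0)) :
    Tendsto (fun n => ∫ x, g n x * inner ℝ (G n x) (w x) ∂π) atTop
      (𝓝 (∫ x, g₀ x * inner ℝ (G₀ x) (w x) ∂π)) := by
  have hi : ∀ n, Integrable (fun x => inner ℝ (G n x - G₀ x) (w x)) π := fun n =>
    MemLp.integrable_inner_mul ((hGm n).sub hG₀) hw
  have hgi : ∀ n, Integrable (fun x => g n x * inner ℝ (G n x - G₀ x) (w x)) π := fun n =>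
    (hi n).bdd_mul (hgm n) (hgC n)
  have h1 : Tendsto (fun n => ∫ x, g n x * inner ℝ (G n x - G₀ x) (w x) ∂π) atTop
      (𝓝 (∫ x, (0 : ℝ) ∂π)) := by
    refine tendsto_integral_of_L1' _ aestronglyMeasurable_const (Eventually.of_forall hgi) ?_
    have hlim : Tendsto (fun n => ENNReal.ofReal C *
        (eLpNorm (fun x => G n x - G₀ x) 2 π * eLpNorm w 2 π)) atTop (𝓝 0) := by
      have h2 := ENNReal.Tendsto.mul_const hG (Or.inr hw.2.ne) (b := eLpNorm w 2 π)
      have h3 := ENNReal.Tendsto.const_mul h2 (Or.inr ENNReal.ofReal_ne_top) (a := ENNReal.ofReal C)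
      simpa using h3
    refine tendsto_of_tendsto_of_tendsto_of_le_of_le tendsto_const_nhds hlim
      (fun _ => zero_le) fun n => ?_
    have h4 : eLpNorm (fun x => inner ℝ (G n x - G₀ x) (w x)) 1 π ≤
        eLpNorm (fun x => G n x - G₀ x) 2 π * eLpNorm w 2 π := by
      have := eLpNorm_le_eLpNorm_mul_eLpNorm'_of_norm (p := 2) (q := 2) (r := 1)
        ((hGm n).sub hG₀).1 hw.1 (fun a b => inner ℝ a b) 1
        (ae_of_all _ fun x => by simpa using norm_inner_le_norm (𝕜 := ℝ) _ _)
      simpa [Pi.sub_def] using this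
    refine le_trans ?_ (mul_le_mul_right h4 _)
    refine eLpNorm_le_mul_eLpNorm_of_ae_le_mul (c := C) ?_ 1
    filter_upwards [hgC n] with x hx
    simp only [Pi.sub_apply, sub_zero, norm_mul]
    gcongr
  have h5 := tendsto_integral_mul_of_bounded hgm hgC hg (hG₀.integrable_inner_mul hw)
  have h6 := h1.add h5
  rw [integral_zero, zero_add] at h6
  refine h6.congr fun n => ?_
  rw [← integral_add (hgi n) ((hG₀.integrable_inner_mul hw).bdd_mul (hgm n) (hgC n))]
  congr 1
  ext x
  rw [inner_sub_left]
  ring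

/-! ### Calculus of test functions. -/

namespace IsTestFunction

variable {d : ℕ} {Ω : Set (EuclideanSpace ℝ (Fin d))} {φ : EuclideanSpace ℝ (Fin d) → ℝ}

theorem differentiable (hφ : IsTestFunction Ω φ) : Differentiable ℝ φ :=
  hφ.contDiff.differentiable (by simp)

theorem continuous_fderiv (hφ : IsTestFunction Ω φ) : Continuous (fderiv ℝ φ) :=
  hφ.contDiff.continuous_fderiv (by simp)

theorem mul_contDiff (hφ : IsTestFunction Ω φ) {g : EuclideanSpace ℝ (Fin d) → ℝ}
    (hg : ContDiff ℝ ∞ g) : IsTestFunction Ω (fun x => φ x * g x) :=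
  ⟨hφ.contDiff.mul hg, hφ.hasCompactSupport.mul_right,
    (closure_mono (Function.support_mul_subset_left _ _)).trans hφ.tsupport_subset⟩

theorem setIntegral_eq_tsupport (hφ : IsTestFunction Ω φ)
    {F : EuclideanSpace ℝ (Fin d) → ℝ} (hF : ∀ x ∉ tsupport φ, F x = 0) :
    ∫ x in Ω, F x = ∫ x in tsupport φ, F x := by
  rw [setIntegral_eq_integral_of_forall_compl_eq_zero,
    setIntegral_eq_integral_of_forall_compl_eq_zero hF]
  exact fun x hx => hF x fun h => hx (hφ.tsupport_subset h)

theorem gradient_eq_zero (_ : IsTestFunction Ω φ) {x : EuclideanSpace ℝ (Fin d)}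
    (hx : x ∉ tsupport φ) : gradient φ x = 0 := by
  have : fderiv ℝ φ x = 0 :=
    image_eq_zero_of_notMem_tsupport fun h => hx (tsupport_fderiv_subset ℝ h)
  simp [gradient, this]

theorem continuous_gradient (hφ : IsTestFunction Ω φ) : Continuous (gradient φ) := by
  unfold gradient
  exact (InnerProductSpace.toDual ℝ _).symm.continuous.comp hφ.continuous_fderiv

end IsTestFunction

theorem _root_.ContDiff.continuous_gradient {H : Type*} [NormedAddCommGroup H]
    [InnerProductSpace ℝ H] [CompleteSpace H] {φ : H → ℝ} (hφ : ContDiff ℝ ∞ φ) :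
    Continuous (gradient φ) := by
  unfold gradient
  exact (InnerProductSpace.toDual ℝ _).symm.continuous.comp
    (hφ.continuous_fderiv (by simp))

theorem _root_.Continuous.memLp_restrict {d : ℕ} {F : Type*} [NormedAddCommGroup F]
    {f : EuclideanSpace ℝ (Fin d) → F}
    (hf : Continuous f) {K : Set (EuclideanSpace ℝ (Fin d))} (hK : IsCompact K) (p : ℝ≥0∞) :
    MemLp f p (volume.restrict K) := by
  obtain ⟨C, hC⟩ := hK.exists_bound_of_continuousOn hf.continuousOn
  have : IsFiniteMeasure (volume.restrict K) := ⟨by simpa using hK.measure_lt_top⟩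
  exact MemLp.of_bound hf.aestronglyMeasurable C
    ((ae_restrict_mem hK.measurableSet).mono fun x hx => hC x hx)

theorem IsTestFunction.integral_mul_fderiv {d : ℕ} {Ω : Set (EuclideanSpace ℝ (Fin d))}
    {φ g : EuclideanSpace ℝ (Fin d) → ℝ} (hφ : IsTestFunction Ω φ) (hg : ContDiff ℝ ∞ g)
    (e : EuclideanSpace ℝ (Fin d)) :
    ∫ x, g x * fderiv ℝ φ x e = - ∫ x, fderiv ℝ g x e * φ x := by
  have hfe : Continuous fun x => fderiv ℝ φ x e := hφ.continuous_fderiv.clm_apply continuous_const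
  have hge : Continuous fun x => fderiv ℝ g x e :=
    (hg.continuous_fderiv (by simp)).clm_apply continuous_const
  have hfs : HasCompactSupport fun x => fderiv ℝ φ x e := by
    exact hφ.hasCompactSupport.fderiv_apply ℝ e
  refine integral_mul_fderiv_eq_neg_fderiv_mul_of_integrable ?_ ?_ ?_ ?_ ?_
  · exact (hge.mul hφ.contDiff.continuous).integrable_of_hasCompactSupport
      hφ.hasCompactSupport.mul_left
  · exact (hg.continuous.mul hfe).integrable_of_hasCompactSupport hfs.mul_left
  · exact (hg.continuous.mul hφ.contDiff.continuous).integrable_of_hasCompactSupport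
      hφ.hasCompactSupport.mul_left
  · exact fun x _ => hg.differentiable (by simp) x
  · exact fun x _ => hφ.differentiable x

/-! ### The logarithm of the weight and the weighted divergence. -/

section Weight

variable {d : ℕ} {X : Set (EuclideanSpace ℝ (Fin d))} {μ : EuclideanSpace ℝ (Fin d) → ℝ}
  {m : EuclideanSpace ℝ (Fin d) → EuclideanSpace ℝ (Fin d)}

/-- For smooth approximants `μ' n` the identity is classical integration by parts. The bounds away
from zero, the pointwise convergence and the `L²` convergence of gradients pass it to the limit. -/
theorem hasWeakGradOn_log (hX : IsCompact X)
    (hμ : ContinuousOn μ X) (hpos : ∀ x ∈ X, 0 < μ x) (hm : HasWeakGradOn (interior X) μ m)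
    (hm2 : LocallyIntegrableOn (fun x => ‖m x‖ ^ 2) (interior X)) :
    HasWeakGradOn (interior X) (fun x => Real.log (μ x)) (fun x => (μ x)⁻¹ • m x) := by
  have hμΩ := hμ.mono interior_subset
  have hne : ∀ x ∈ interior X, μ x ≠ 0 := fun x hx => (hpos x (interior_subset hx)).ne'
  refine ⟨(hμΩ.log hne).locallyIntegrableOn isOpen_interior.measurableSet,
    hm.locallyIntegrableOn_grad.continuousOn_smul isOpen_interior.isLocallyClosed
      (hμΩ.inv₀ hne), fun φ hφ e => ?_⟩
  have hK : IsCompact (tsupport φ) := hφ.hasCompactSupport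
  obtain ⟨μ', a, b, ha, hab, hsm, hb, hlim, hmK, hgrad⟩ :=
    exists_contDiff_approx hX hμ hpos hm hm2 hK hφ.tsupport_subset
  have hpos' : ∀ n x, 0 < μ' n x := fun n x => ha.trans_le (hb n x).1
  have hlog : ∀ n, ContDiff ℝ ∞ (fun x => Real.log (μ' n x)) := fun n =>
    (hsm n).log fun x => (hpos' n x).ne'
  obtain ⟨Cφ, hCφ⟩ := hφ.contDiff.continuous.bounded_above_of_compact_support hφ.hasCompactSupport
  have haeK : ∀ᵐ x ∂(volume.restrict (tsupport φ)), x ∈ tsupport φ :=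
    ae_restrict_mem hK.measurableSet
  have hKX : ∀ x ∈ tsupport φ, 0 < μ x := fun x hx =>
    hpos x (interior_subset (hφ.tsupport_subset hx))
  have hfz : ∀ x ∉ tsupport φ, fderiv ℝ φ x e = 0 := fun x hx => by
    rw [← inner_gradient, hφ.gradient_eq_zero hx, inner_zero_left]
  have h1 : Tendsto (fun n => ∫ x in tsupport φ, Real.log (μ' n x) * fderiv ℝ φ x e) atTop
      (𝓝 (∫ x in tsupport φ, Real.log (μ x) * fderiv ℝ φ x e)) := by
    refine tendsto_integral_mul_of_bounded (C := max |Real.log a| |Real.log b|)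
      (fun n => (hlog n).continuous.aestronglyMeasurable) (fun n => ae_of_all _ fun x => ?_) ?_ ?_
    · exact abs_le_max_abs_abs (Real.log_le_log ha (hb n x).1)
        (Real.log_le_log (hpos' n x) (hb n x).2)
    · filter_upwards [haeK] with x hx
      exact (hlim x hx).log (hKX x hx).ne'
    · exact memLp_one_iff_integrable.1 ((hφ.continuous_fderiv.clm_apply
        continuous_const).memLp_restrict hK 1)
  have h2 : Tendsto (fun n => ∫ x in tsupport φ, (φ x / μ' n x) * inner ℝ (gradient (μ' n) x) e)
      atTop (𝓝 (∫ x in tsupport φ, (φ x / μ x) * inner ℝ (m x) e)) := by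
    refine tendsto_integral_mul_inner (C := Cφ / a) (fun n => ?_) (fun n => ae_of_all _ fun x => ?_)
      ?_ (fun n => (hsm n).continuous_gradient.memLp_restrict hK 2) hmK
      (continuous_const.memLp_restrict hK 2) hgrad
    · exact (hφ.contDiff.continuous.div (hsm n).continuous
        fun x => (hpos' n x).ne').aestronglyMeasurable
    · rw [norm_div, Real.norm_of_nonneg (hpos' n x).le]
      exact div_le_div₀ ((norm_nonneg _).trans (hCφ x)) (hCφ x) ha (hb n x).1
    · filter_upwards [haeK] with x hx
      exact tendsto_const_nhds.div (hlim x hx) (hKX x hx).ne'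
  have h3 : ∀ n, ∫ x in tsupport φ, Real.log (μ' n x) * fderiv ℝ φ x e =
      - ∫ x in tsupport φ, (φ x / μ' n x) * inner ℝ (gradient (μ' n) x) e := by
    intro n
    rw [setIntegral_eq_integral_of_forall_compl_eq_zero (fun x hx => by rw [hfz x hx, mul_zero]),
      hφ.integral_mul_fderiv (hlog n), setIntegral_eq_integral_of_forall_compl_eq_zero
      (fun x hx => by rw [image_eq_zero_of_notMem_tsupport hx]; simp)]
    congr 2
    ext x
    rw [fderiv.log ((hsm n).differentiable (by simp) x) (hpos' n x).ne', inner_gradient]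
    simp only [_root_.smul_apply, smul_eq_mul]
    ring
  rw [hφ.setIntegral_eq_tsupport (fun x hx => by rw [hfz x hx, mul_zero]),
    hφ.setIntegral_eq_tsupport
      (fun x hx => by rw [image_eq_zero_of_notMem_tsupport hx, mul_zero]),
    tendsto_nhds_unique (h1.congr h3) h2.neg]
  congr 2
  ext x
  rw [inner_smul_left]
  simp only [conj_trivial]
  ring

/-- The product rule `div v = μ⁻¹ div (μ v) - ⟨μ⁻¹ ∇μ, v⟩`. -/
theorem hasWeakDivOn_of_weighted (hX : IsCompact X)
    (hμ : ContinuousOn μ X) (hpos : ∀ x ∈ X, 0 < μ x) (hm : HasWeakGradOn (interior X) μ m)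
    (hm2 : LocallyIntegrableOn (fun x => ‖m x‖ ^ 2) (interior X))
    {v : EuclideanSpace ℝ (Fin d) → EuclideanSpace ℝ (Fin d)}
    (hv : MemLp v 2 (volume.restrict X))
    {r : EuclideanSpace ℝ (Fin d) → ℝ} (hr : LocallyIntegrableOn r (interior X))
    (h : ∀ ψ, IsTestFunction (interior X) ψ →
      ∫ x in interior X, μ x * inner ℝ (v x) (gradient ψ x) = - ∫ x in interior X, r x * ψ x) :
    HasWeakDivOn (interior X) v (fun x => r x / μ x - inner ℝ ((μ x)⁻¹ • m x) (v x)) := by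
  have hμΩ := hμ.mono interior_subset
  have hne : ∀ x ∈ interior X, μ x ≠ 0 := fun x hx => (hpos x (interior_subset hx)).ne'
  have hvK : ∀ K ⊆ interior X, MemLp v 2 (volume.restrict K) := fun K hK =>
    hv.mono_measure (Measure.restrict_mono (hK.trans interior_subset) le_rfl)
  have hmL : ∀ K, IsCompact K → K ⊆ interior X → MemLp m 2 (volume.restrict K) := by
    intro K hK hKX
    obtain ⟨_, _, _, _, _, _, _, _, hmK, _⟩ :=
      exists_contDiff_approx hX hμ hpos hm hm2 hK hKX
    exact hmK
  have hmv : LocallyIntegrableOn (fun x => inner ℝ (m x) (v x)) (interior X) := by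
    rw [locallyIntegrableOn_iff isOpen_interior.isLocallyClosed]
    exact fun K hKX hK => (hmL K hK hKX).integrable_inner_mul (hvK K hKX)
  have hr' : LocallyIntegrableOn (fun x => r x / μ x) (interior X) := by
    simpa [div_eq_inv_mul] using hr.continuousOn_smul isOpen_interior.isLocallyClosed (hμΩ.inv₀ hne)
  refine ⟨?_, hr'.sub ?_, fun φ hφ => ?_⟩
  · rw [locallyIntegrableOn_iff isOpen_interior.isLocallyClosed]
    intro K hKX hK
    have : IsFiniteMeasure (volume.restrict K) := ⟨by simpa using hK.measure_lt_top⟩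
    exact (hvK K hKX).integrable (by norm_num)
  · simpa [inner_smul_left] using
      hmv.continuousOn_smul isOpen_interior.isLocallyClosed (hμΩ.inv₀ hne)
  have hK : IsCompact (tsupport φ) := hφ.hasCompactSupport
  obtain ⟨μ', a, b, ha, hab, hsm, hb, hlim, hmK, hgrad⟩ :=
    exists_contDiff_approx hX hμ hpos hm hm2 hK hφ.tsupport_subset
  have hpos' : ∀ n x, 0 < μ' n x := fun n x => ha.trans_le (hb n x).1
  obtain ⟨Cφ, hCφ⟩ := hφ.contDiff.continuous.bounded_above_of_compact_support hφ.hasCompactSupport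
  obtain ⟨Cμ, hCμ⟩ := hX.exists_bound_of_continuousOn hμ
  have haeK : ∀ᵐ x ∂(volume.restrict (tsupport φ)), x ∈ tsupport φ :=
    ae_restrict_mem hK.measurableSet
  have hKX' : tsupport φ ⊆ X := hφ.tsupport_subset.trans interior_subset
  have hKX : ∀ x ∈ tsupport φ, 0 < μ x := fun x hx => hpos x (hKX' hx)
  have hμm : AEStronglyMeasurable μ (volume.restrict (tsupport φ)) :=
    (hμ.mono hKX').aestronglyMeasurable hK.measurableSet
  have hvφ := hvK _ hφ.tsupport_subset
  have hcinv : ∀ n, Continuous fun x => (μ' n x)⁻¹ := fun n =>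
    (hsm n).continuous.inv₀ fun x => (hpos' n x).ne'
  have hinv : ∀ n x, ‖(μ' n x)⁻¹‖ ≤ a⁻¹ := fun n x => by
    rw [norm_inv, Real.norm_of_nonneg (hpos' n x).le]
    exact inv_anti₀ ha (hb n x).1
  have hliminv : ∀ x ∈ tsupport φ, Tendsto (fun n => (μ' n x)⁻¹) atTop (𝓝 (μ x)⁻¹) :=
    fun x hx => (hlim x hx).inv₀ (hKX x hx).ne'
  have h1 : Tendsto (fun n => ∫ x in tsupport φ, (μ x * (μ' n x)⁻¹) *
      inner ℝ (gradient φ x) (v x)) atTop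
      (𝓝 (∫ x in tsupport φ, (μ x * (μ x)⁻¹) * inner ℝ (gradient φ x) (v x))) := by
    refine tendsto_integral_mul_of_bounded (C := Cμ * a⁻¹)
      (fun n => hμm.mul (hcinv n).aestronglyMeasurable) (fun n => ?_) ?_
      ((hφ.continuous_gradient.memLp_restrict hK 2).integrable_inner_mul hvφ)
    · filter_upwards [haeK] with x hx
      rw [norm_mul]
      exact mul_le_mul (hCμ x (hKX' hx)) (hinv n x) (norm_nonneg _)
        ((norm_nonneg _).trans (hCμ x (hKX' hx)))
    · filter_upwards [haeK] with x hx using (hliminv x hx).const_mul _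
  have h2 : Tendsto (fun n => ∫ x in tsupport φ, (μ x * φ x * ((μ' n x)⁻¹ * (μ' n x)⁻¹)) *
      inner ℝ (gradient (μ' n) x) (v x)) atTop
      (𝓝 (∫ x in tsupport φ, (μ x * φ x * ((μ x)⁻¹ * (μ x)⁻¹)) * inner ℝ (m x) (v x))) := by
    refine tendsto_integral_mul_inner (C := Cμ * Cφ * (a⁻¹ * a⁻¹)) (fun n => ?_) (fun n => ?_)
      ?_ (fun n => (hsm n).continuous_gradient.memLp_restrict hK 2) hmK hvφ hgrad
    · exact (hμm.mul hφ.contDiff.continuous.aestronglyMeasurable).mul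
        ((hcinv n).mul (hcinv n)).aestronglyMeasurable
    · filter_upwards [haeK] with x hx
      have hC0 := (norm_nonneg _).trans (hCφ x)
      have hCμ0 := (norm_nonneg _).trans (hCμ x (hKX' hx))
      rw [norm_mul, norm_mul, norm_mul]
      gcongr
      · exact hCμ x (hKX' hx)
      · exact hCφ x
      · exact hinv n x
      · exact hinv n x
    · filter_upwards [haeK] with x hx
      exact ((hliminv x hx).mul (hliminv x hx)).const_mul _
  have h3 : Tendsto (fun n => ∫ x in tsupport φ, (φ x * (μ' n x)⁻¹) * r x) atTop
      (𝓝 (∫ x in tsupport φ, (φ x * (μ x)⁻¹) * r x)) := by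
    refine tendsto_integral_mul_of_bounded (C := Cφ * a⁻¹)
      (fun n => (hφ.contDiff.continuous.mul (hcinv n)).aestronglyMeasurable)
      (fun n => ae_of_all _ fun x => ?_) ?_
      (hr.integrableOn_compact_subset hφ.tsupport_subset hK)
    · rw [norm_mul]
      exact mul_le_mul (hCφ x) (hinv n x) (norm_nonneg _) ((norm_nonneg _).trans (hCφ x))
    · filter_upwards [haeK] with x hx using (hliminv x hx).const_mul _
  have hgv : IntegrableOn (fun x => inner ℝ (gradient φ x) (v x)) (tsupport φ) :=
    (hφ.continuous_gradient.memLp_restrict hK 2).integrable_inner_mul hvφ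
  have h4 : ∀ n, (∫ x in tsupport φ, (μ x * (μ' n x)⁻¹) * inner ℝ (gradient φ x) (v x)) -
      (∫ x in tsupport φ, (μ x * φ x * ((μ' n x)⁻¹ * (μ' n x)⁻¹)) *
        inner ℝ (gradient (μ' n) x) (v x)) =
      - ∫ x in tsupport φ, (φ x * (μ' n x)⁻¹) * r x := by
    intro n
    -- The natural test function `φ / μ` need not be smooth, so `φ / μ' n` is inserted into `h`
    -- instead. The expanded identity is `h4`, and its limit gives the claim.
    have hψ : IsTestFunction (interior X) (fun x => φ x * (μ' n x)⁻¹) := hφ.mul_contDiff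
      ((hsm n).inv fun x => (hpos' n x).ne')
    have hψz : ∀ x ∉ tsupport φ, φ x * (μ' n x)⁻¹ = 0 := fun x hx => by
      rw [image_eq_zero_of_notMem_tsupport hx, zero_mul]
    have hψs : tsupport (fun x => φ x * (μ' n x)⁻¹) ⊆ tsupport φ :=
      closure_mono (Function.support_mul_subset_left _ _)
    have hinner : ∀ x w, inner ℝ w (gradient (fun x => φ x * (μ' n x)⁻¹) x) =
        (μ' n x)⁻¹ * inner ℝ (gradient φ x) w -
          φ x * ((μ' n x)⁻¹ * (μ' n x)⁻¹) * inner ℝ (gradient (μ' n) x) w := by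
      intro x w
      have hd : HasFDerivAt (fun x => φ x * (μ' n x)⁻¹) _ x :=
        (hφ.differentiable x).hasFDerivAt.mul
          ((hasDerivAt_inv (hpos' n x).ne').comp_hasFDerivAt x
            ((hsm n).differentiable (by simp) x).hasFDerivAt)
      rw [real_inner_comm, inner_gradient, inner_gradient, inner_gradient, hd.fderiv]
      simp only [_root_.add_apply, _root_.smul_apply, smul_eq_mul]
      have := (hpos' n x).ne'
      field_simp
      ring
    have hint := h _ hψ
    rw [hφ.setIntegral_eq_tsupport (fun x hx => by
        rw [hψ.gradient_eq_zero fun h => hx (hψs h)]; simp),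
      hφ.setIntegral_eq_tsupport (fun x hx => by rw [hψz x hx, mul_zero])] at hint
    rw [← integral_sub]
    · convert hint using 2
      · ext x
        rw [hinner]
        ring
      · congr 1
        ext x
        ring
    · refine hgv.bdd_mul (c := Cμ * a⁻¹) (hμm.mul (hcinv n).aestronglyMeasurable) ?_
      filter_upwards [haeK] with x hx
      rw [norm_mul]
      exact mul_le_mul (hCμ x (hKX' hx)) (hinv n x) (norm_nonneg _)
        ((norm_nonneg _).trans (hCμ x (hKX' hx)))
    · refine (((hsm n).continuous_gradient.memLp_restrict hK 2).integrable_inner_mul hvφ).bdd_mul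
        (c := Cμ * Cφ * (a⁻¹ * a⁻¹)) ((hμm.mul hφ.contDiff.continuous.aestronglyMeasurable).mul
        ((hcinv n).mul (hcinv n)).aestronglyMeasurable) ?_
      filter_upwards [haeK] with x hx
      have hC0 := (norm_nonneg _).trans (hCφ x)
      have hCμ0 := (norm_nonneg _).trans (hCμ x (hKX' hx))
      rw [norm_mul, norm_mul, norm_mul]
      gcongr
      · exact hCμ x (hKX' hx)
      · exact hCφ x
      · exact hinv n x
      · exact hinv n x
  have h5 := tendsto_nhds_unique ((h1.sub h2).congr h4) h3.neg
  have hcμ : ContinuousOn (fun x => φ x * (μ x)⁻¹) (tsupport φ) :=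
    hφ.contDiff.continuous.continuousOn.mul ((hμ.mono hKX').inv₀ fun x hx => (hKX x hx).ne')
  rw [hφ.setIntegral_eq_tsupport (fun x hx => by rw [hφ.gradient_eq_zero hx]; simp),
    hφ.setIntegral_eq_tsupport (fun x hx => by
      rw [image_eq_zero_of_notMem_tsupport hx]; simp)]
  have h6 : ∫ x in tsupport φ, (r x / μ x - inner ℝ ((μ x)⁻¹ • m x) (v x)) * φ x =
      (∫ x in tsupport φ, (φ x * (μ x)⁻¹) * r x) -
        ∫ x in tsupport φ, (μ x * φ x * ((μ x)⁻¹ * (μ x)⁻¹)) * inner ℝ (m x) (v x) := by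
    rw [← integral_sub]
    · refine setIntegral_congr_fun hK.measurableSet fun x hx => ?_
      simp only [inner_smul_left, conj_trivial]
      have := (hKX x hx).ne'
      field_simp
    · exact (hr.integrableOn_compact_subset hφ.tsupport_subset hK).continuousOn_smul hcμ hK
    · have hmvφ : IntegrableOn (fun x => inner ℝ (m x) (v x)) (tsupport φ) :=
        hmK.integrable_inner_mul hvφ
      refine (hmvφ.continuousOn_smul hcμ hK).congr ?_
      filter_upwards [haeK] with x hx
      have := (hKX x hx).ne'
      simp only [smul_eq_mul]
      field_simp
  have h7 : ∫ x in tsupport φ, inner ℝ (v x) (gradient φ x) =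
      ∫ x in tsupport φ, (μ x * (μ x)⁻¹) * inner ℝ (gradient φ x) (v x) := by
    refine setIntegral_congr_fun hK.measurableSet fun x hx => ?_
    simp only [mul_inv_cancel₀ (hKX x hx).ne', one_mul, real_inner_comm]
  rw [h6, h7]
  linarith

end Weight

/-! ### The Poincaré inequality and Lax–Milgram. -/

/-- The Poincaré inequality for test functions on a bounded set. -/
theorem IsTestFunction.integral_sq_le {d : ℕ} {Ω : Set (EuclideanSpace ℝ (Fin d))}
    {φ : EuclideanSpace ℝ (Fin d) → ℝ} (hφ : IsTestFunction Ω φ) {R : ℝ}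
    (hR : ∀ x ∈ Ω, ‖x‖ ≤ R) {e : EuclideanSpace ℝ (Fin d)} (he : ‖e‖ = 1) :
    ∫ x, φ x ^ 2 ≤ 4 * R ^ 2 * ∫ x, ‖gradient φ x‖ ^ 2 := by
  have hl : ContDiff ℝ ∞ (fun x : EuclideanSpace ℝ (Fin d) => inner ℝ e x) :=
    (innerSL ℝ e).contDiff
  have hg : ContDiff ℝ ∞ (fun x => inner ℝ e x * φ x) := hl.mul hφ.contDiff
  have hc := hφ.contDiff.continuous
  have hce : Continuous fun x => fderiv ℝ φ x e := hφ.continuous_fderiv.clm_apply continuous_const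
  -- With `g = ⟨e, x⟩ φ` and `‖e‖ = 1`, integration by parts gives `∫ φ² = -2 ∫ ⟨e, x⟩ φ ∂_e φ`.
  have h1 := hφ.integral_mul_fderiv hg e
  have hi1 : Integrable (fun x => φ x ^ 2) :=
    (hc.pow 2).integrable_of_hasCompactSupport
      (HasCompactSupport.intro hφ.hasCompactSupport fun x hx => by
        simp [image_eq_zero_of_notMem_tsupport hx])
  have hi2 : Integrable (fun x => (inner ℝ e x * φ x) * fderiv ℝ φ x e) :=
    ((hl.continuous.mul hc).mul hce).integrable_of_hasCompactSupport
      hφ.hasCompactSupport.mul_left.mul_right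
  have hi3 : Integrable (fun x => ‖gradient φ x‖ ^ 2) :=
    (hφ.continuous_gradient.norm.pow 2).integrable_of_hasCompactSupport
      (HasCompactSupport.intro hφ.hasCompactSupport fun x hx => by
        simp [hφ.gradient_eq_zero hx])
  have h2 : ∀ x, fderiv ℝ (fun x => inner ℝ e x * φ x) x e * φ x =
      φ x ^ 2 + (inner ℝ e x * φ x) * fderiv ℝ φ x e := by
    intro x
    have hd : HasFDerivAt (fun x => inner ℝ e x) (innerSL ℝ e) x :=
      (innerSL ℝ e).hasFDerivAt
    rw [(hd.fun_mul (hφ.differentiable x).hasFDerivAt).fderiv]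
    simp only [_root_.add_apply, _root_.smul_apply, smul_eq_mul, innerSL_apply_apply,
      real_inner_self_eq_norm_sq, he]
    ring
  simp_rw [h2] at h1
  rw [integral_add hi1 hi2] at h1
  -- Young's inequality with weight `1/2` lets `∫ φ²` be absorbed on the left, whence the constant
  -- `4 R²`.
  have h4 : ∫ x, -2 * ((inner ℝ e x * φ x) * fderiv ℝ φ x e) ≤
      ∫ x, ((1 / 2) * φ x ^ 2 + 2 * R ^ 2 * ‖gradient φ x‖ ^ 2) := by
    refine integral_mono (hi2.const_mul _) ((hi1.const_mul _).add (hi3.const_mul _)) fun x => ?_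
    by_cases hx : x ∈ Ω
    · have h5 : |inner ℝ e x| ≤ R := by
        refine (abs_real_inner_le_norm e x).trans ?_
        rw [he, one_mul]
        exact hR x hx
      have h6 : |fderiv ℝ φ x e| ≤ ‖gradient φ x‖ := by
        rw [← inner_gradient]
        simpa [he] using abs_real_inner_le_norm (gradient φ x) e
      have h7 : |inner ℝ e x * fderiv ℝ φ x e| ≤ R * ‖gradient φ x‖ := by
        rw [abs_mul]
        exact mul_le_mul h5 h6 (abs_nonneg _) ((abs_nonneg _).trans h5)
      have h8 : (inner ℝ e x * fderiv ℝ φ x e) ^ 2 ≤ (R * ‖gradient φ x‖) ^ 2 :=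
        sq_le_sq' (neg_le_of_abs_le h7) (le_of_abs_le h7)
      simp only
      nlinarith [sq_nonneg (φ x + 2 * (inner ℝ e x * fderiv ℝ φ x e))]
    · simp only [hφ.eq_zero_of_notMem hx]
      simp
      positivity
  rw [integral_add (hi1.const_mul _) (hi3.const_mul _), integral_const_mul,
    integral_const_mul, integral_const_mul] at h4
  linarith

/-- The Lax–Milgram theorem for a form that is coercive by a Poincaré type inequality. -/
theorem exists_inner_snd_eq_inner_fst {H₁ H₂ : Type*} [NormedAddCommGroup H₁]
    [InnerProductSpace ℝ H₁] [CompleteSpace H₁] [NormedAddCommGroup H₂] [InnerProductSpace ℝ H₂]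
    [CompleteSpace H₂] {V : Submodule ℝ (WithLp 2 (H₁ × H₂))}
    (hV : IsClosed (V : Set (WithLp 2 (H₁ × H₂)))) {C : ℝ}
    (hC : ∀ z ∈ V, ‖z.fst‖ ^ 2 ≤ C * ‖z.snd‖ ^ 2) (h : H₁) :
    ∃ u ∈ V, ∀ z ∈ V, inner ℝ u.snd z.snd = inner ℝ h z.fst := by
  have : CompleteSpace V := hV.completeSpace_coe
  let S : V →L[ℝ] H₂ := (WithLp.sndL 2 ℝ H₁ H₂).comp V.subtypeL
  let T : V →L[ℝ] H₁ := (WithLp.fstL 2 ℝ H₁ H₂).comp V.subtypeL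
  let B : V →L[ℝ] V →L[ℝ] ℝ := (innerSL ℝ).bilinearComp S S
  have hB : IsCoercive B := by
    -- The form sees only the second component; the hypothesis `hC` gives `‖z‖² ≤ (1 + |C|)
    -- ‖z.snd‖²`.
    refine ⟨(1 + |C|)⁻¹, by positivity, fun z => ?_⟩
    have h1 : B z z = ‖(z : WithLp 2 (H₁ × H₂)).snd‖ ^ 2 := real_inner_self_eq_norm_sq _
    have h2 : ‖z‖ ^ 2 = ‖(z : WithLp 2 (H₁ × H₂)).fst‖ ^ 2 +
        ‖(z : WithLp 2 (H₁ × H₂)).snd‖ ^ 2 := by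
      rw [← WithLp.prod_norm_sq_eq_of_L2]; rfl
    rw [h1, mul_assoc, ← sq, h2, inv_mul_le_iff₀ (by positivity)]
    nlinarith [hC z z.2, le_abs_self C, sq_nonneg ‖(z : WithLp 2 (H₁ × H₂)).snd‖]
  let ℓ : V →L[ℝ] ℝ := (innerSL ℝ h).comp T
  let u : V := hB.continuousLinearEquivOfBilin.symm ((InnerProductSpace.toDual ℝ V).symm ℓ)
  refine ⟨u, u.2, fun z hz => ?_⟩
  have h1 := hB.continuousLinearEquivOfBilin_apply u ⟨z, hz⟩
  rw [ContinuousLinearEquiv.apply_symm_apply, InnerProductSpace.toDual_symm_apply] at h1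
  exact h1.symm

/-! ### Comparison of the weighted measure with Lebesgue measure. -/

theorem integral_densityMeasure {d : ℕ} {X : Set (EuclideanSpace ℝ (Fin d))}
    (hX : MeasurableSet X) {p : EuclideanSpace ℝ (Fin d) → ℝ}
    (hp : AEMeasurable p (volume.restrict X)) (hp0 : ∀ x ∈ X, 0 ≤ p x)
    (f : EuclideanSpace ℝ (Fin d) → ℝ) :
    ∫ x, f x ∂(densityMeasure X p) = ∫ x in X, p x * f x := by
  rw [densityMeasure, integral_withDensity_eq_integral_toReal_smul₀ hp.ennreal_ofReal (by simp)]
  refine setIntegral_congr_fun hX fun x hx => ?_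
  simp [ENNReal.toReal_ofReal (hp0 x hx)]

/-- A continuous positive weight on a compact set with null boundary. -/
structure IsWeight {d : ℕ} (X : Set (EuclideanSpace ℝ (Fin d)))
    (μ : EuclideanSpace ℝ (Fin d) → ℝ) : Prop where
  isCompact : IsCompact X
  frontier_null : volume (frontier X) = 0
  continuousOn : ContinuousOn μ X
  pos : ∀ x ∈ X, 0 < μ x

namespace IsWeight

variable {d : ℕ} {X : Set (EuclideanSpace ℝ (Fin d))} {μ : EuclideanSpace ℝ (Fin d) → ℝ}

theorem measurableSet (hw : IsWeight X μ) : MeasurableSet X := hw.isCompact.measurableSet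

theorem restrict_interior (hw : IsWeight X μ) :
    volume.restrict (interior X) = volume.restrict X :=
  Measure.restrict_congr_set (interior_ae_eq_of_null_frontier hw.frontier_null)

theorem isFiniteMeasure_restrict (hw : IsWeight X μ) : IsFiniteMeasure (volume.restrict X) :=
  ⟨by simpa using hw.isCompact.measure_lt_top⟩

theorem aestronglyMeasurable (hw : IsWeight X μ) :
    AEStronglyMeasurable μ (volume.restrict X) :=
  hw.continuousOn.aestronglyMeasurable hw.measurableSet

theorem exists_le_densityMeasure_le (hw : IsWeight X μ) : ∃ a b : ℝ, 0 < a ∧ a ≤ b ∧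
    (∀ x ∈ X, a ≤ μ x ∧ μ x ≤ b) ∧
    densityMeasure X μ ≤ ENNReal.ofReal b • volume.restrict X ∧
    volume.restrict X ≤ (ENNReal.ofReal a)⁻¹ • densityMeasure X μ := by
  obtain ⟨a, b, ha, hab, h⟩ := exists_bounds_of_continuousOn_pos hw.isCompact hw.continuousOn hw.pos
  refine ⟨a, b, ha, hab, h, ?_, ?_⟩
  · rw [← withDensity_const, densityMeasure]
    refine withDensity_mono ?_
    filter_upwards [ae_restrict_mem hw.measurableSet] with x hx
    exact ENNReal.ofReal_le_ofReal (h x hx).2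
  · have h1 : ENNReal.ofReal a • volume.restrict X ≤ densityMeasure X μ := by
      rw [← withDensity_const, densityMeasure]
      refine withDensity_mono ?_
      filter_upwards [ae_restrict_mem hw.measurableSet] with x hx
      exact ENNReal.ofReal_le_ofReal (h x hx).1
    calc volume.restrict X
        = (ENNReal.ofReal a)⁻¹ • ENNReal.ofReal a • volume.restrict X := by
          rw [smul_smul, ENNReal.inv_mul_cancel (by simpa using ha) ENNReal.ofReal_ne_top, one_smul]
      _ ≤ _ := by gcongr

theorem memLp_iff (hw : IsWeight X μ) {F : Type*} [NormedAddCommGroup F]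
    {f : EuclideanSpace ℝ (Fin d) → F} {p : ℝ≥0∞} :
    MemLp f p (densityMeasure X μ) ↔ MemLp f p (volume.restrict X) := by
  obtain ⟨a, b, ha, -, -, h1, h2⟩ := hw.exists_le_densityMeasure_le
  exact ⟨fun h => h.of_measure_le_smul (by simpa using ha) h2,
    fun h => h.of_measure_le_smul ENNReal.ofReal_ne_top h1⟩

theorem isFiniteMeasure (hw : IsWeight X μ) : IsFiniteMeasure (densityMeasure X μ) := by
  obtain ⟨a, b, ha, -, -, h1, -⟩ := hw.exists_le_densityMeasure_le
  have := hw.isFiniteMeasure_restrict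
  refine ⟨(h1 Set.univ).trans_lt ?_⟩
  exact ENNReal.mul_lt_top ENNReal.ofReal_lt_top (measure_lt_top _ _)

theorem integral_eq (hw : IsWeight X μ) (f : EuclideanSpace ℝ (Fin d) → ℝ) :
    ∫ x, f x ∂(densityMeasure X μ) = ∫ x in X, μ x * f x :=
  integral_densityMeasure hw.measurableSet hw.aestronglyMeasurable.aemeasurable
    (fun x hx => (hw.pos x hx).le) f

/-- Turns the Lebesgue integrals in the weak formulations into inner products in `L²(μ)`; the null
frontier allows passing between `X` and its interior. -/
theorem setIntegral_interior_eq (hw : IsWeight X μ) (f : EuclideanSpace ℝ (Fin d) → ℝ) :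
    ∫ x in interior X, f x = ∫ x, f x / μ x ∂(densityMeasure X μ) := by
  rw [hw.integral_eq, hw.restrict_interior]
  refine setIntegral_congr_fun hw.measurableSet fun x hx => ?_
  exact (mul_div_cancel₀ _ (hw.pos x hx).ne').symm

theorem memLp_div (hw : IsWeight X μ) {f : EuclideanSpace ℝ (Fin d) → ℝ}
    (hf : MemLp f 2 (volume.restrict X)) :
    MemLp (fun x => f x / μ x) 2 (densityMeasure X μ) := by
  obtain ⟨a, b, ha, -, h, -, -⟩ := hw.exists_le_densityMeasure_le
  refine hw.memLp_iff.2 (hf.of_le_mul (c := a⁻¹)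
    (hf.1.div₀ hw.aestronglyMeasurable) ?_)
  filter_upwards [ae_restrict_mem hw.measurableSet] with x hx
  rw [norm_div, div_eq_inv_mul, Real.norm_of_nonneg (hw.pos x hx).le]
  gcongr
  exact (h x hx).1

theorem locallyIntegrableOn (hw : IsWeight X μ) {F : Type*} [NormedAddCommGroup F]
    {f : EuclideanSpace ℝ (Fin d) → F} (hf : MemLp f 2 (volume.restrict X)) :
    LocallyIntegrableOn f (interior X) := by
  have := hw.isFiniteMeasure_restrict
  have h : IntegrableOn f X := hf.integrable (by norm_num)
  exact (h.mono_set interior_subset).locallyIntegrableOn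

theorem memLp_testFunction (hw : IsWeight X μ) {Ω : Set (EuclideanSpace ℝ (Fin d))}
    {φ : EuclideanSpace ℝ (Fin d) → ℝ}
    (hφ : IsTestFunction Ω φ) : MemLp φ 2 (densityMeasure X μ) :=
  hw.memLp_iff.2 (hφ.contDiff.continuous.memLp_restrict hw.isCompact 2)

theorem memLp_gradient (hw : IsWeight X μ) {Ω : Set (EuclideanSpace ℝ (Fin d))}
    {φ : EuclideanSpace ℝ (Fin d) → ℝ}
    (hφ : IsTestFunction Ω φ) : MemLp (gradient φ) 2 (densityMeasure X μ) :=
  hw.memLp_iff.2 (hφ.continuous_gradient.memLp_restrict hw.isCompact 2)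

end IsWeight

/-! ### The weighted Sobolev space as a closed graph. -/

namespace IsTestFunction

variable {d : ℕ} {Ω : Set (EuclideanSpace ℝ (Fin d))} {φ ψ : EuclideanSpace ℝ (Fin d) → ℝ}

theorem zero : IsTestFunction Ω (fun _ => 0) :=
  ⟨contDiff_const, HasCompactSupport.zero, by simp [tsupport]⟩

theorem add (hφ : IsTestFunction Ω φ) (hψ : IsTestFunction Ω ψ) :
    IsTestFunction Ω (fun x => φ x + ψ x) :=
  ⟨hφ.contDiff.add hψ.contDiff, hφ.hasCompactSupport.add hψ.hasCompactSupport,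
    (tsupport_add φ ψ).trans (Set.union_subset hφ.tsupport_subset hψ.tsupport_subset)⟩

theorem const_mul (hφ : IsTestFunction Ω φ) (c : ℝ) : IsTestFunction Ω (fun x => c * φ x) := by
  simpa [mul_comm] using hφ.mul_contDiff (g := fun _ => c) contDiff_const

theorem gradient_add (hφ : IsTestFunction Ω φ) (hψ : IsTestFunction Ω ψ)
    (x : EuclideanSpace ℝ (Fin d)) :
    gradient (fun x => φ x + ψ x) x = gradient φ x + gradient ψ x := by
  simp [gradient, fderiv_fun_add (hφ.differentiable x) (hψ.differentiable x)]

theorem gradient_const_mul (hφ : IsTestFunction Ω φ) (c : ℝ) (x : EuclideanSpace ℝ (Fin d)) :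
    gradient (fun x => c * φ x) x = c • gradient φ x := by
  simp [gradient, fderiv_const_mul (hφ.differentiable x)]

end IsTestFunction

theorem gradient_zero {d : ℕ} (x : EuclideanSpace ℝ (Fin d)) :
    gradient (fun _ : EuclideanSpace ℝ (Fin d) => (0 : ℝ)) x = 0 := by
  simp [gradient]

/-- Pairs of square integrable functions and vector fields. -/
abbrev GraphSpace {d : ℕ} (ν : Measure (EuclideanSpace ℝ (Fin d))) : Type :=
  WithLp 2 (Lp ℝ 2 ν × Lp (EuclideanSpace ℝ (Fin d)) 2 ν)

/-- The pairs `(φ, ∇φ)` for test functions `φ`. -/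
noncomputable def testGraph {d : ℕ} (Ω : Set (EuclideanSpace ℝ (Fin d)))
    (ν : Measure (EuclideanSpace ℝ (Fin d))) : Submodule ℝ (GraphSpace ν) where
  carrier := {z | ∃ φ, IsTestFunction Ω φ ∧ z.fst =ᵐ[ν] φ ∧ z.snd =ᵐ[ν] gradient φ}
  zero_mem' := by
    refine ⟨fun _ => 0, IsTestFunction.zero, Lp.coeFn_zero _ _ _, ?_⟩
    refine (Lp.coeFn_zero _ _ _).trans (ae_of_all _ fun x => ?_)
    rw [gradient_zero]; rfl
  add_mem' := by
    rintro z w ⟨φ, hφ, h1, h2⟩ ⟨ψ, hψ, h3, h4⟩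
    refine ⟨_, hφ.add hψ, ?_, ?_⟩
    · filter_upwards [Lp.coeFn_add z.fst w.fst, h1, h3] with x hx h1 h3
      rw [WithLp.add_fst, hx, Pi.add_apply, h1, h3]
    · filter_upwards [Lp.coeFn_add z.snd w.snd, h2, h4] with x hx h2 h4
      rw [WithLp.add_snd, hx, Pi.add_apply, h2, h4, hφ.gradient_add hψ]
  smul_mem' := by
    rintro c z ⟨φ, hφ, h1, h2⟩
    refine ⟨_, hφ.const_mul c, ?_, ?_⟩
    · filter_upwards [Lp.coeFn_smul c z.fst, h1] with x hx h1
      rw [WithLp.smul_fst, hx, Pi.smul_apply, h1, smul_eq_mul]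
    · filter_upwards [Lp.coeFn_smul c z.snd, h2] with x hx h2
      rw [WithLp.smul_snd, hx, Pi.smul_apply, h2, hφ.gradient_const_mul]

/-- The weighted Sobolev space of functions vanishing at the boundary of `Ω`. -/
noncomputable def sobolevGraph {d : ℕ} (Ω : Set (EuclideanSpace ℝ (Fin d)))
    (ν : Measure (EuclideanSpace ℝ (Fin d))) : Submodule ℝ (GraphSpace ν) :=
  (testGraph Ω ν).topologicalClosure

theorem inner_eq_integral {α H : Type*} [MeasurableSpace α] {ν : Measure α}
    [NormedAddCommGroup H] [InnerProductSpace ℝ H] {z w : Lp H 2 ν} {f g : α → H}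
    (hf : z =ᵐ[ν] f) (hg : w =ᵐ[ν] g) :
    inner ℝ z w = ∫ x, inner ℝ (f x) (g x) ∂ν := by
  rw [L2.inner_def]
  refine integral_congr_ae ?_
  filter_upwards [hf, hg] with x h1 h2
  rw [h1, h2]

theorem norm_sq_eq_integral {α H : Type*} [MeasurableSpace α] {ν : Measure α}
    [NormedAddCommGroup H] [InnerProductSpace ℝ H] {z : Lp H 2 ν} {f : α → H}
    (hf : z =ᵐ[ν] f) : ‖z‖ ^ 2 = ∫ x, ‖f x‖ ^ 2 ∂ν := by
  rw [← real_inner_self_eq_norm_sq, inner_eq_integral hf hf]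
  simp

namespace IsWeight

variable {d : ℕ} {X : Set (EuclideanSpace ℝ (Fin d))} {μ : EuclideanSpace ℝ (Fin d) → ℝ}

/-- The inequality is a closed condition, so it suffices to check it on test functions. There the
unweighted inequality applies, and the bounds `a ≤ μ ≤ b` cost a factor `b / a`. A unit direction
exists only for `d ≠ 0`. -/
theorem exists_poincare (hw : IsWeight X μ) (hd : d ≠ 0) :
    ∃ C : ℝ, ∀ z ∈ sobolevGraph (interior X) (densityMeasure X μ),
      ‖z.fst‖ ^ 2 ≤ C * ‖z.snd‖ ^ 2 := by
  obtain ⟨a, b, ha, hab, hμ, -, -⟩ := hw.exists_le_densityMeasure_le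
  obtain ⟨R, hR⟩ := hw.isCompact.isBounded.exists_norm_le
  have : NeZero d := ⟨hd⟩
  have hcl : IsClosed {z : GraphSpace (densityMeasure X μ) |
      ‖z.fst‖ ^ 2 ≤ (b / a * (4 * R ^ 2)) * ‖z.snd‖ ^ 2} :=
    isClosed_le (by fun_prop) (by fun_prop)
  refine ⟨b / a * (4 * R ^ 2), fun z hz => closure_minimal ?_ hcl hz⟩
  rintro z ⟨φ, hφ, h1, h2⟩
  have hP := hφ.integral_sq_le (fun x hx => hR x (interior_subset hx))
    (e := EuclideanSpace.single 0 1) (by simp)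
  have hφ2 := (hφ.contDiff.continuous.memLp_restrict hw.isCompact 2).integrable_sq
  have hg2 := (memLp_two_iff_integrable_sq_norm
    hφ.continuous_gradient.aestronglyMeasurable).1
    (hφ.continuous_gradient.memLp_restrict hw.isCompact 2)
  have e1 : ∫ x, φ x ^ 2 = ∫ x in X, φ x ^ 2 := by
    rw [setIntegral_eq_integral_of_forall_compl_eq_zero]
    intro x hx
    rw [hφ.eq_zero_of_notMem fun h => hx (interior_subset h)]
    norm_num
  have e2 : ∫ x, ‖gradient φ x‖ ^ 2 = ∫ x in X, ‖gradient φ x‖ ^ 2 := by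
    rw [setIntegral_eq_integral_of_forall_compl_eq_zero]
    intro x hx
    rw [hφ.gradient_eq_zero fun h => hx (interior_subset (hφ.tsupport_subset h))]
    simp
  obtain ⟨B, hB⟩ := hw.isCompact.exists_bound_of_continuousOn hw.continuousOn
  have hbd : ∀ᵐ x ∂(volume.restrict X), ‖μ x‖ ≤ B :=
    (ae_restrict_mem hw.measurableSet).mono hB
  have i1 : ∫ x in X, μ x * ‖φ x‖ ^ 2 ≤ b * ∫ x in X, φ x ^ 2 := by
    rw [← integral_const_mul]
    simp only [Real.norm_eq_abs, sq_abs]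
    refine setIntegral_mono_on (hφ2.bdd_mul hw.aestronglyMeasurable hbd) (hφ2.const_mul b)
      hw.measurableSet fun x hx => ?_
    exact mul_le_mul_of_nonneg_right (hμ x hx).2 (sq_nonneg _)
  have i2 : a * ∫ x in X, ‖gradient φ x‖ ^ 2 ≤ ∫ x in X, μ x * ‖gradient φ x‖ ^ 2 := by
    rw [← integral_const_mul]
    refine setIntegral_mono_on (hg2.const_mul a) (hg2.bdd_mul hw.aestronglyMeasurable hbd)
      hw.measurableSet fun x hx => ?_
    exact mul_le_mul_of_nonneg_right (hμ x hx).1 (sq_nonneg _)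
  rw [e1, e2] at hP
  simp only [Set.mem_ofPred_eq]
  rw [norm_sq_eq_integral h1, norm_sq_eq_integral h2, hw.integral_eq, hw.integral_eq]
  have hb : 0 < b := ha.trans_le hab
  calc ∫ x in X, μ x * ‖φ x‖ ^ 2 ≤ b * ∫ x in X, φ x ^ 2 := i1
    _ ≤ b * (4 * R ^ 2 * ∫ x in X, ‖gradient φ x‖ ^ 2) := by gcongr
    _ = b / a * (4 * R ^ 2) * (a * ∫ x in X, ‖gradient φ x‖ ^ 2) := by field_simp
    _ ≤ _ := by gcongr

theorem mem_sobolevGraph (hw : IsWeight X μ) {f : EuclideanSpace ℝ (Fin d) → ℝ}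
    {v : EuclideanSpace ℝ (Fin d) → EuclideanSpace ℝ (Fin d)} (h : MemSobolevZero X μ f v) :
    (WithLp.toLp 2 (h.memLp.toLp f, h.memLp_grad.toLp v) : GraphSpace (densityMeasure X μ)) ∈
      sobolevGraph (interior X) (densityMeasure X μ) := by
  obtain ⟨φ, hφ, h1, h2⟩ := h.exists_approx
  refine mem_closure_of_tendsto (f := fun n => (WithLp.toLp 2 ((hw.memLp_testFunction (hφ n)).toLp
    (φ n), (hw.memLp_gradient (hφ n)).toLp (gradient (φ n))) : GraphSpace (densityMeasure X μ)))
    (b := atTop) ?_ (Eventually.of_forall fun n => ⟨φ n, hφ n,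
      (hw.memLp_testFunction (hφ n)).coeFn_toLp, (hw.memLp_gradient (hφ n)).coeFn_toLp⟩)
  refine ((WithLp.prod_continuous_toLp 2 _ _).tendsto _).comp (Tendsto.prodMk_nhds ?_ ?_)
  · rw [tendsto_iff_edist_tendsto_0]
    exact h1.congr fun n => (Lp.edist_toLp_toLp _ _ _ _).symm
  · rw [tendsto_iff_edist_tendsto_0]
    exact h2.congr fun n => (Lp.edist_toLp_toLp _ _ _ _).symm

theorem memSobolevZero (hw : IsWeight X μ) {z : GraphSpace (densityMeasure X μ)}
    (hz : z ∈ sobolevGraph (interior X) (densityMeasure X μ)) :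
    MemSobolevZero X μ z.fst z.snd := by
  have m1 := Lp.memLp z.fst
  have m2 := Lp.memLp z.snd
  refine ⟨⟨hw.locallyIntegrableOn (hw.memLp_iff.1 m1), hw.locallyIntegrableOn (hw.memLp_iff.1 m2),
    fun η hη e => ?_⟩, m1, m2, ?_⟩
  · have k1 : MemLp (fun x => fderiv ℝ η x e / μ x) 2 (densityMeasure X μ) :=
      hw.memLp_div ((hη.continuous_fderiv.clm_apply continuous_const).memLp_restrict
        hw.isCompact 2)
    have k2 : MemLp (fun x => (η x / μ x) • e) 2 (densityMeasure X μ) :=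
      (ContinuousLinearMap.toSpanSingleton ℝ e).comp_memLp'
        (hw.memLp_div (hη.contDiff.continuous.memLp_restrict hw.isCompact 2))
    -- For fixed `η` and `e`, the weak gradient identity is the vanishing of a continuous functional
    -- of the pair `w`. It holds on test graphs by integration by parts, hence on the closure.
    have key : ∀ w ∈ sobolevGraph (interior X) (densityMeasure X μ),
        inner ℝ (k1.toLp _) w.fst + inner ℝ (k2.toLp _) w.snd = 0 := by
      intro w hw'
      have hcl : IsClosed {w : GraphSpace (densityMeasure X μ) |
          inner ℝ (k1.toLp _) w.fst + inner ℝ (k2.toLp _) w.snd = 0} :=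
        isClosed_eq (by fun_prop) continuous_const
      refine closure_minimal ?_ hcl hw'
      rintro w ⟨φ, hφ, h1, h2⟩
      simp only [Set.mem_ofPred_eq]
      rw [inner_eq_integral (k1.coeFn_toLp) h1, inner_eq_integral (k2.coeFn_toLp) h2]
      have h3 : ∫ x, inner ℝ (fderiv ℝ η x e / μ x) (φ x) ∂(densityMeasure X μ) =
          ∫ x in interior X, φ x * fderiv ℝ η x e := by
        rw [hw.setIntegral_interior_eq]
        congr 1
        ext x
        simp
        ring
      have h4 : ∫ x, inner ℝ ((η x / μ x) • e) (gradient φ x) ∂(densityMeasure X μ) =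
          ∫ x in interior X, fderiv ℝ φ x e * η x := by
        rw [hw.setIntegral_interior_eq]
        congr 1
        ext x
        rw [inner_smul_left, real_inner_comm, inner_gradient]
        simp
        ring
      rw [h3, h4, setIntegral_eq_integral_of_forall_compl_eq_zero,
        setIntegral_eq_integral_of_forall_compl_eq_zero, hη.integral_mul_fderiv hφ.contDiff,
        neg_add_cancel]
      · intro x hx
        rw [hη.eq_zero_of_notMem hx, mul_zero]
      · intro x hx
        rw [hη.fderiv_eq_zero_of_notMem hx]
        simp
    have h3 := key z hz
    rw [inner_eq_integral (k1.coeFn_toLp) (ae_eq_refl _),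
      inner_eq_integral (k2.coeFn_toLp) (ae_eq_refl _)] at h3
    rw [hw.setIntegral_interior_eq, hw.setIntegral_interior_eq, eq_neg_iff_add_eq_zero, ← h3]
    congr 2
    · ext x; simp; ring
    · ext x; rw [inner_smul_left, real_inner_comm]; simp; ring
  · obtain ⟨w, hwm, hwt⟩ := mem_closure_iff_seq_limit.1 hz
    choose φ hφ h1 h2 using hwm
    refine ⟨φ, hφ, ?_, ?_⟩
    · have h3 := ((WithLp.fstL 2 ℝ _ _).continuous.tendsto z).comp hwt
      have h4 := tendsto_iff_edist_tendsto_0.1 h3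
      refine h4.congr fun n => ?_
      rw [Function.comp_apply, Lp.edist_def]
      refine eLpNorm_congr_ae ?_
      filter_upwards [h1 n] with x hx
      rw [← hx]; rfl
    · have h3 := ((WithLp.sndL 2 ℝ _ _).continuous.tendsto z).comp hwt
      have h4 := tendsto_iff_edist_tendsto_0.1 h3
      refine h4.congr fun n => ?_
      rw [Function.comp_apply, Lp.edist_def]
      refine eLpNorm_congr_ae ?_
      filter_upwards [h2 n] with x hx
      rw [← hx]; rfl

end IsWeight

/-! ### The dual problem and the Stein operator. -/

namespace IsWeight

variable {d : ℕ} {X : Set (EuclideanSpace ℝ (Fin d))} {μ : EuclideanSpace ℝ (Fin d) → ℝ}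

theorem meanDiscrepancy_eq (hw : IsWeight X μ) {P Q f : EuclideanSpace ℝ (Fin d) → ℝ}
    (hP : IsDensityOn X P) (hQ : IsDensityOn X Q)
    (hP2 : MemLp P 2 (volume.restrict X)) (hQ2 : MemLp Q 2 (volume.restrict X))
    (hf : MemLp f 2 (densityMeasure X μ)) :
    meanDiscrepancy X P Q f =
      inner ℝ ((hw.memLp_div (hP2.sub hQ2)).toLp _) (hf.toLp f) := by
  have hf' := hw.memLp_iff.1 hf
  have h1 : Integrable (fun x => P x * f x) (volume.restrict X) := hP2.integrable_mul hf'
  have h2 : Integrable (fun x => Q x * f x) (volume.restrict X) := hQ2.integrable_mul hf'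
  rw [meanDiscrepancy, integral_densityMeasure hw.measurableSet hP2.1.aemeasurable hP.nonneg,
    integral_densityMeasure hw.measurableSet hQ2.1.aemeasurable hQ.nonneg, ← integral_sub h1 h2,
    inner_eq_integral (MemLp.coeFn_toLp _) (MemLp.coeFn_toLp _), hw.integral_eq]
  refine setIntegral_congr_fun hw.measurableSet fun x hx => ?_
  have := (hw.pos x hx).ne'
  simp
  field_simp

theorem isSteinImage_of_weak (hw : IsWeight X μ)
    {m : EuclideanSpace ℝ (Fin d) → EuclideanSpace ℝ (Fin d)}
    (hm : HasWeakGradOn (interior X) μ m)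
    (hm2 : LocallyIntegrableOn (fun x => ‖m x‖ ^ 2) (interior X))
    {v : EuclideanSpace ℝ (Fin d) → EuclideanSpace ℝ (Fin d)}
    (hv : MemLp v 2 (densityMeasure X μ))
    {r : EuclideanSpace ℝ (Fin d) → ℝ} (hr : MemLp r 2 (volume.restrict X))
    (h : ∀ ψ, IsTestFunction (interior X) ψ →
      ∫ x, inner ℝ (v x) (gradient ψ x) ∂(densityMeasure X μ) =
        - ∫ x, r x / μ x * ψ x ∂(densityMeasure X μ)) :
    IsSteinImage X μ v (fun x => 1 / 2 * (r x / μ x)) := by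
  -- The representative of the weak divergence contains `-⟨∇ log μ, v⟩` explicitly, so the Stein
  -- image equals `r / (2 μ)` at every point and not just almost everywhere.
  refine ⟨_, _, hasWeakGradOn_log hw.isCompact hw.continuousOn hw.pos hm hm2,
    hasWeakDivOn_of_weighted hw.isCompact hw.continuousOn hw.pos hm hm2 (hw.memLp_iff.1 hv)
      (hw.locallyIntegrableOn hr) (fun ψ hψ => ?_), fun x => by ring⟩
  rw [hw.restrict_interior, ← hw.integral_eq, h ψ hψ, hw.integral_eq]
  congr 1
  refine setIntegral_congr_fun hw.measurableSet fun x hx => ?_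
  have := (hw.pos x hx).ne'
  field_simp

/-- In dimension zero the Poincaré inequality is unavailable; there the datum is assumed to vanish
and `u = 0` works. -/
theorem exists_dual (hw : IsWeight X μ) {h : Lp ℝ 2 (densityMeasure X μ)}
    (h0 : d = 0 → h = 0) :
    ∃ u ∈ sobolevGraph (interior X) (densityMeasure X μ),
      ∀ z ∈ sobolevGraph (interior X) (densityMeasure X μ),
        inner ℝ u.snd z.snd = inner ℝ h z.fst := by
  by_cases hd : d = 0
  · refine ⟨0, zero_mem _, fun z _ => ?_⟩
    rw [h0 hd, inner_zero_left, WithLp.zero_snd, inner_zero_left]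
  · obtain ⟨C, hC⟩ := hw.exists_poincare hd
    exact exists_inner_snd_eq_inner_fst (Submodule.isClosed_topologicalClosure _) hC h

/-- Testing the dual equation with `(ψ, ∇ψ)` gives `div(μ v) = -c r` weakly. In the application `c`
is the reciprocal of `‖∇u‖`. -/
theorem isSteinImage_of_toLp_eq (hw : IsWeight X μ)
    {m : EuclideanSpace ℝ (Fin d) → EuclideanSpace ℝ (Fin d)}
    (hm : HasWeakGradOn (interior X) μ m)
    (hm2 : LocallyIntegrableOn (fun x => ‖m x‖ ^ 2) (interior X))
    {r : EuclideanSpace ℝ (Fin d) → ℝ} (hr : MemLp r 2 (volume.restrict X))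
    {u : GraphSpace (densityMeasure X μ)}
    (hu : ∀ z ∈ sobolevGraph (interior X) (densityMeasure X μ),
        inner ℝ u.snd z.snd = inner ℝ ((hw.memLp_div hr).toLp _) z.fst)
    {v : EuclideanSpace ℝ (Fin d) → EuclideanSpace ℝ (Fin d)}
    (hv : MemLp v 2 (densityMeasure X μ)) {c : ℝ} (hvu : hv.toLp v = c • u.snd) :
    IsSteinImage X μ v (fun x => 1 / 2 * (-c * r x / μ x)) := by
  refine hw.isSteinImage_of_weak hm hm2 hv (hr.const_mul (-c)) fun ψ hψ => ?_
  have h1 := hw.memLp_testFunction hψ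
  have h2 := hw.memLp_gradient hψ
  have h3 := hu (WithLp.toLp 2 (h1.toLp ψ, h2.toLp (gradient ψ)))
    (Submodule.le_topologicalClosure _ ⟨ψ, hψ, h1.coeFn_toLp, h2.coeFn_toLp⟩)
  rw [← inner_eq_integral hv.coeFn_toLp h2.coeFn_toLp, hvu, real_inner_smul_left]
  change inner ℝ u.snd (h2.toLp _) = inner ℝ _ (h1.toLp ψ) at h3
  rw [h3, inner_eq_integral (MemLp.coeFn_toLp _) h1.coeFn_toLp, ← integral_const_mul,
    ← integral_neg]
  congr 1
  ext x
  simp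
  ring

/-- The fundamental lemma of the calculus of variations. It settles the degenerate case: if `∇u =
0`, then `P = Q` almost everywhere. -/
theorem ae_eq_zero_of_inner_eq_zero (hw : IsWeight X μ)
    {r : EuclideanSpace ℝ (Fin d) → ℝ} (hr : MemLp r 2 (volume.restrict X))
    (h : ∀ z ∈ sobolevGraph (interior X) (densityMeasure X μ),
        inner ℝ ((hw.memLp_div hr).toLp _) z.fst = 0) :
    ∀ᵐ x ∂(volume.restrict X), r x = 0 := by
  rw [← hw.restrict_interior, ae_restrict_iff' isOpen_interior.measurableSet]
  refine isOpen_interior.ae_eq_zero_of_integral_contDiff_smul_eq_zero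
    (hw.locallyIntegrableOn hr) fun ψ hψ1 hψ2 hψ3 => ?_
  have hψ : IsTestFunction (interior X) ψ := ⟨hψ1, hψ2, hψ3⟩
  have h1 := hw.memLp_testFunction hψ
  have h2 := hw.memLp_gradient hψ
  have h3 := h (WithLp.toLp 2 (h1.toLp ψ, h2.toLp (gradient ψ)))
    (Submodule.le_topologicalClosure _ ⟨ψ, hψ, h1.coeFn_toLp, h2.coeFn_toLp⟩)
  rw [WithLp.toLp_fst, inner_eq_integral (MemLp.coeFn_toLp _) h1.coeFn_toLp] at h3
  rw [← h3, ← setIntegral_eq_integral_of_forall_compl_eq_zero (s := interior X)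
    (fun x hx => by rw [hψ.eq_zero_of_notMem hx, zero_smul]), hw.setIntegral_interior_eq]
  congr 1
  ext x
  simp
  ring

end IsWeight

/-! ### Equality in Cauchy–Schwarz, and dimension zero. -/

/-- Expanding `‖v - u / ‖u‖‖²` gives at most `1 - 2 + 1 = 0`. -/
theorem eq_smul_of_norm_le_inner {H : Type*} [NormedAddCommGroup H] [InnerProductSpace ℝ H]
    {u v : H} (hu : u ≠ 0) (hv : ‖v‖ ≤ 1) (h : ‖u‖ ≤ inner ℝ u v) : v = ‖u‖⁻¹ • u := by
  have hu' : 0 < ‖u‖ := norm_pos_iff.2 hu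
  have h1 : ‖v - ‖u‖⁻¹ • u‖ ^ 2 ≤ 0 := by
    rw [norm_sub_sq_real, real_inner_smul_right, norm_smul, norm_inv, norm_norm,
      inv_mul_cancel₀ hu'.ne', real_inner_comm]
    have h2 : 1 ≤ ‖u‖⁻¹ * inner ℝ u v := by
      rw [inv_mul_eq_div, one_le_div hu']
      exact h
    have h3 : ‖v‖ ^ 2 ≤ 1 := pow_le_one₀ (norm_nonneg _) hv
    linarith
  have h4 : ‖v - ‖u‖⁻¹ • u‖ = 0 := pow_eq_zero_iff two_ne_zero |>.1 (le_antisymm h1 (sq_nonneg _))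
  exact sub_eq_zero.1 (norm_eq_zero.1 h4)

theorem eq_of_isDensityOn_fin_zero {X : Set (EuclideanSpace ℝ (Fin 0))}
    {P Q : EuclideanSpace ℝ (Fin 0) → ℝ}
    (hP : IsDensityOn X P) (hQ : IsDensityOn X Q) : ∀ x, P x = Q x := by
  have h : ∀ p : EuclideanSpace ℝ (Fin 0) → ℝ, IsDensityOn X p →
      volume.real X * p 0 = 1 := by
    intro p hp
    rw [← hp.integral_eq_one, ← smul_eq_mul, ← setIntegral_const]
    congr 1
    ext x
    rw [Subsingleton.elim x 0]
  intro x
  rw [Subsingleton.elim x 0]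
  have h1 := h P hP
  have h2 := h Q hQ
  have h3 : volume.real X ≠ 0 := fun h0 => by simp [h0] at h1
  exact mul_left_cancel₀ h3 (h1.trans h2.symm)

end SobolevStein


/-! ### The discrepancy inequality. -/

theorem theorem4 {d : ℕ} (X : Set (EuclideanSpace ℝ (Fin d)))
    (hX : IsCompact X) (hfr : volume (frontier X) = 0)
    (μ P Q : EuclideanSpace ℝ (Fin d) → ℝ)
    (hμ : SobolevStein.IsDensityOn X μ)
    (hP : SobolevStein.IsDensityOn X P)
    (hQ : SobolevStein.IsDensityOn X Q)
    (hμ_cont : ContinuousOn μ X) (hμ_pos : ∀ x ∈ X, 0 < μ x)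
    (hμ_grad : ∃ m : EuclideanSpace ℝ (Fin d) → EuclideanSpace ℝ (Fin d),
      SobolevStein.HasWeakGradOn (interior X) μ m ∧
      LocallyIntegrableOn (fun x => ‖m x‖ ^ 2) (interior X))
    (hP_sq : MemLp P 2 (volume.restrict X)) (hQ_sq : MemLp Q 2 (volume.restrict X)) :
    Integrable (fun x => (Q x - P x) / μ x) (SobolevStein.densityMeasure X Q) ∧
    ENNReal.ofReal |∫ x, (Q x - P x) / μ x ∂(SobolevStein.densityMeasure X Q)| ≤
      2 * SobolevStein.steinDiscrepancy X (SobolevStein.steinClass X μ) Q μ *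
        SobolevStein.sobolevIPM X μ P Q ∧
    (∃ (f : EuclideanSpace ℝ (Fin d) → ℝ)
      (v : EuclideanSpace ℝ (Fin d) → EuclideanSpace ℝ (Fin d)),
      SobolevStein.IsSobolevCritic X μ P Q f v ∧ v ∈ SobolevStein.steinClass X μ) ∧
    (∀ (f : EuclideanSpace ℝ (Fin d) → ℝ)
      (v : EuclideanSpace ℝ (Fin d) → EuclideanSpace ℝ (Fin d))
      (𝒢 : Set (EuclideanSpace ℝ (Fin d) → EuclideanSpace ℝ (Fin d))),
      SobolevStein.IsSobolevCritic X μ P Q f v → v ∈ 𝒢 →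
      ENNReal.ofReal |∫ x, (Q x - P x) / μ x ∂(SobolevStein.densityMeasure X Q)| ≤
        2 * SobolevStein.steinDiscrepancy X 𝒢 Q μ * SobolevStein.sobolevIPM X μ P Q) := by
  open SobolevStein in
  have hw : IsWeight X μ := ⟨hX, hfr, hμ_cont, hμ_pos⟩
  obtain ⟨m, hm, hm2⟩ := hμ_grad
  have hr : MemLp (fun x => P x - Q x) 2 (volume.restrict X) := hP_sq.sub hQ_sq
  have hh := hw.memLp_div hr
  set ν := densityMeasure X μ
  have hfin : IsFiniteMeasure ν := hw.isFiniteMeasure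
  obtain ⟨u, huV, hu⟩ := hw.exists_dual (h := hh.toLp _) (by
    rintro rfl
    refine (MemLp.toLp_congr hh MemLp.zero (ae_of_all _ fun x => ?_)).trans (MemLp.toLp_zero _)
    simp [eq_of_isDensityOn_fin_zero hP hQ x])
  have hdisc : ∀ f v (hf : MemSobolevZero X μ f v),
      meanDiscrepancy X P Q f = inner ℝ u.snd (hf.memLp_grad.toLp v) := by
    intro f v hf
    rw [hw.meanDiscrepancy_eq hP hQ hP_sq hQ_sq hf.memLp]
    exact (hu _ (hw.mem_sobolevGraph hf)).symm
  have hball : ∀ f v (hf : InSobolevBall X μ f v), ‖hf.1.memLp_grad.toLp v‖ ≤ 1 := by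
    intro f v hf
    have h1 := hf.2
    rw [← norm_sq_eq_integral hf.1.memLp_grad.coeFn_toLp] at h1
    exact (sq_le_one_iff₀ (norm_nonneg _)).1 h1
  have hint : Integrable (fun x => (Q x - P x) / μ x) (densityMeasure X Q) := by
    rw [densityMeasure, integrable_withDensity_iff_integrable_smul₀'
      hQ_sq.1.aemeasurable.ennreal_ofReal (by simp)]
    have h1 : Integrable (fun x => Q x * ((Q x - P x) / μ x)) (volume.restrict X) :=
      hQ_sq.integrable_mul (hw.memLp_iff.1 (hw.memLp_div (hQ_sq.sub hP_sq)))
    refine h1.congr ?_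
    filter_upwards [ae_restrict_mem hX.measurableSet] with x hx
    rw [ENNReal.toReal_ofReal (hQ.nonneg x hx), smul_eq_mul]
  -- The inverse of zero is zero, so for `∇u = 0` this is the zero critic and existence needs no
  -- separate case.
  have hz : ‖u.snd‖⁻¹ • u ∈ sobolevGraph (interior X) ν := Submodule.smul_mem _ _ huV
  have hS := hw.memSobolevZero hz
  have hsnd : hS.memLp_grad.toLp _ = ‖u.snd‖⁻¹ • u.snd := Lp.toLp_coeFn _ _
  have hB : InSobolevBall X μ (‖u.snd‖⁻¹ • u).fst (‖u.snd‖⁻¹ • u).snd := by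
    refine ⟨hS, ?_⟩
    rw [← norm_sq_eq_integral (ae_eq_refl _), WithLp.smul_snd, norm_smul, norm_inv, norm_norm]
    exact pow_le_one₀ (by positivity) inv_mul_le_one
  have hBdisc : meanDiscrepancy X P Q (‖u.snd‖⁻¹ • u).fst = ‖u.snd‖ := by
    rw [hdisc _ _ hB.1, hsnd, real_inner_smul_right, real_inner_self_eq_norm_sq]
    rcases eq_or_ne ‖u.snd‖ 0 with h0 | h0
    · simp [h0]
    · field_simp
  have hcritic : ∃ f v, IsSobolevCritic X μ P Q f v ∧ v ∈ steinClass X μ := by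
    refine ⟨_, _, ⟨hB, fun f' v' hf' => ?_⟩, _,
      hw.isSteinImage_of_toLp_eq hm hm2 hr hu hS.memLp_grad hsnd, ?_, ?_⟩
    · rw [hdisc _ _ hf'.1, hBdisc]
      exact (real_inner_le_norm _ _).trans
        (mul_le_of_le_one_right (norm_nonneg _) (hball _ _ hf'))
    · exact ((hw.memLp_div (hr.const_mul _)).integrable (by norm_num)).const_mul _
    · rw [integral_const_mul, ← hw.setIntegral_interior_eq, hw.restrict_interior,
        integral_const_mul, integral_sub hP.integrableOn hQ.integrableOn, hP.integral_eq_one,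
        hQ.integral_eq_one]
      simp
  have hmain : ∀ f v 𝒢, IsSobolevCritic X μ P Q f v → v ∈ 𝒢 →
      ENNReal.ofReal |∫ x, (Q x - P x) / μ x ∂(densityMeasure X Q)| ≤
        2 * steinDiscrepancy X 𝒢 Q μ * sobolevIPM X μ P Q := by
    intro f v 𝒢 hfv hv𝒢
    by_cases hu0 : u.snd = 0
    · have h0 := hw.ae_eq_zero_of_inner_eq_zero hr fun z hz => by
        rw [← hu z hz, hu0, inner_zero_left]
      have h1 : ∫ x, (Q x - P x) / μ x ∂(densityMeasure X Q) = 0 := by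
        refine integral_eq_zero_of_ae ?_
        refine (withDensity_absolutelyContinuous _ _).ae_le ?_
        filter_upwards [h0] with x hx
        rw [sub_eq_zero.1 hx]
        simp
      simp [h1]
    · have hS0 : 0 < ‖u.snd‖ := norm_pos_iff.2 hu0
      have hle : ‖u.snd‖ ≤ meanDiscrepancy X P Q f := hBdisc.symm.trans_le (hfv.2 _ _ hB)
      -- An arbitrary optimal critic does at least as well as `u / ‖∇u‖`, so the equality case
      -- identifies its gradient and hence its Stein image.
      have hv := eq_smul_of_norm_le_inner hu0 (hball _ _ hfv.1)
        (hle.trans_eq (hdisc _ _ hfv.1.1))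
      have ht := hw.isSteinImage_of_toLp_eq hm hm2 hr hu hfv.1.1.memLp_grad hv
      have hteq : (fun x => 1 / 2 * (-‖u.snd‖⁻¹ * (P x - Q x) / μ x)) =
          fun x => (1 / 2 * ‖u.snd‖⁻¹) * ((Q x - P x) / μ x) := by
        ext x
        ring
      rw [hteq] at ht
      have h1 : ENNReal.ofReal |∫ x, (1 / 2 * ‖u.snd‖⁻¹) * ((Q x - P x) / μ x)
          ∂(densityMeasure X Q)| ≤ steinDiscrepancy X 𝒢 Q μ :=
        le_iSup₂_of_le v hv𝒢 (le_iSup₂_of_le _ ht (le_iSup_of_le (hint.const_mul _) le_rfl))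
      have h2 : ENNReal.ofReal ‖u.snd‖ ≤ sobolevIPM X μ P Q :=
        le_iSup₂_of_le f v (le_iSup_of_le hfv.1 (ENNReal.ofReal_le_ofReal hle))
      -- No loss occurs here: with `A` the left side and `S = ‖∇u‖`, `A = 2 · (A / (2 S)) · S`.
      refine le_trans (le_of_eq ?_) (mul_le_mul' (mul_le_mul' le_rfl h1) h2)
      rw [integral_const_mul, abs_mul]
      generalize |∫ x, (Q x - P x) / μ x ∂(densityMeasure X Q)| = A
      generalize ‖u.snd‖ = S at hS0 ⊢
      rw [abs_of_pos (by positivity), ← ENNReal.ofReal_ofNat 2,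
        ← ENNReal.ofReal_mul (by norm_num), ← ENNReal.ofReal_mul' hS0.le]
      congr 1
      field_simp
  obtain ⟨f, v, hfv, hvs⟩ := hcritic
  exact ⟨hint, hmain f v _ hfv hvs, ⟨f, v, hfv, hvs⟩, hmain⟩
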